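/- Setting. Let $M$ be a smooth (Hausdorff) manifold of dimension $n\ge 2$ and let $k\ge 3$. A symbol of degree $k$ is a smooth section $\sigma$ of $S^kTM$, i.e. a smooth field of symmetric $k$-linear forms on the cotangent spaces. Its conformal class is $[\sigma]=\{f\sigma\}$, $f$ running over the smooth nowhere vanishing functions on $M$. An affine connection $\nabla$ on $M$ (always smooth) acts on symbols by $(\nabla_X\sigma)(\alpha_1,\dots,\alpha_k)=X(\sigma(\alpha_1,\dots,\alpha_k))-\sum_i\sigma(\alpha_1,\dots,\nabla_X\alpha_i,\dots,\alpha_k)$. It preserves $[\sigma]$ if $\nabla_X\sigma=\eta(X)\sigma$ for some 1-form $\eta$. Its torsion form is $\theta(X)=\operatorname{Tr}(Y\mapsto T(X,Y))$, where $T(X,Y)=\nabla_XY-\nabla_YX-[X,Y]$. A Wagner connection of a symbol $\tau$ is an affine connection with $\nabla_X\tau=0$ for all $X$. Regular forms. A rational invariant $J$ of order $\le 3$ is a $GL(n)$-invariant rational function on the bundle of $3$-jets, at points $x\neq 0$ of $\mathbb R^n$, of homogeneous polynomials of degree $k$; write $J(h)(x)=J(j_3h(x))$. A homogeneous polynomial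 $h$ of degree $k$ on $\mathbb R^n$ is regular if there is a point $x\ne0$ such that: (i) $h(x)\neq0$ and the Hessian $d^2h_x$ is non-degenerate; (ii) if $B,C$ are the restrictions of $d^2h_x,d^3h_x$ to $\ker dh_x$, $\ell\in\ker dh_x$ is the vector $B$-dual to the trace of $C$ with respect to $B$, and $\Phi$ is given by $B(\Phi Y,Z)=C(\ell,Y,Z)$, then $\ell,\Phi\ell,\dots,\Phi^{n-2}\ell$ are linearly independent; (iii) there are rational invariants $J_1,\dots,J_{n-1}$ of order $\le3$, defined at $j_3h(x)$, such that $dJ_1(h)\wedge\dots\wedge dJ_{n-1}(h)\wedge dh\ne0$ at $x$. A regular orbit is the $GL(n)$-orbit $\varpi\subset S^k\mathbb R^n$ of a tensor which is regular as a polynomial on $(\mathbb R^n)^*$. A symbol $\sigma$ is regular of constant type if, for some regular orbit $\varpi$, $\phi_*\sigma_p\in\varpi$ for every $p\in M$ and every linear isomorphism $\phi:T_pM\to\mathbb R^n$. Theorem (Chern connection). Let $\sigma$ be a regular symbol of degree $k\ge3$ of constant type on $M$. Then every $\tau\in[\sigma]$ has a unique Wagner connection $\nabla^\tau$, with torsion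 form denoted $\theta^\tau$, and: 1. There is an affine connection $\nabla^{[\sigma]}$, depending only on the conformal class $[\sigma]$, such that for every $\tau\in[\sigma]$ $$\nabla^{[\sigma]}_XY=\nabla^{\tau}_XY-\frac1{n-1}\,\theta^{\tau}(X)\,Y .$$ It preserves the conformal class: for every $\tau\in[\sigma]$, $$\nabla^{[\sigma]}_X\tau=-\frac{k}{n-1}\,\theta^{\tau}(X)\,\tau ,$$ and it is the only affine connection satisfying this equation (for any one $\tau\in[\sigma]$). 2. The torsion form of $\nabla^{[\sigma]}$ is zero. Moreover, $\nabla^{[\sigma]}$ is the only affine connection that preserves $[\sigma]$ and has zero torsion form. -/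

import Mathlib

open Bundle FiberBundle
open scoped Manifold ContDiff

noncomputable section

namespace ChernConn

/-! ### Symmetric contravariant tensors and `GL`-orbits -/

/-- Elements of `S^k V`: symmetric `k`-linear forms on the dual of a (finite-dimensional) space. -/
structure SymTensor (k : ℕ) (V : Type*) [AddCommGroup V] [Module ℝ V] [TopologicalSpace V]
    [IsTopologicalAddGroup V] [ContinuousSMul ℝ V] where
  toMul : MultilinearMap ℝ (fun _ : Fin k => V →L[ℝ] ℝ) ℝ
  symm' : ∀ (e : Equiv.Perm (Fin k)) (v : Fin k → V →L[ℝ] ℝ),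
    toMul (fun i => v (e i)) = toMul v

namespace SymTensor

variable {k : ℕ} {V W : Type*}
  [AddCommGroup V] [Module ℝ V] [TopologicalSpace V]
  [IsTopologicalAddGroup V] [ContinuousSMul ℝ V]
  [AddCommGroup W] [Module ℝ W] [TopologicalSpace W]
  [IsTopologicalAddGroup W] [ContinuousSMul ℝ W]

/-- The push-forward `φ_* S`, `(φ_* S)(α₁, …, α_k) = S(α₁ ∘ φ, …, α_k ∘ φ)`. -/
def push (φ : V ≃L[ℝ] W) (S : SymTensor k V) : SymTensor k W where
  toMul := S.toMul.compLinearMap fun _ =>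
    { toFun := fun α => α.comp (φ : V →L[ℝ] W)
      map_add' := fun _ _ => rfl
      map_smul' := fun _ _ => rfl }
  symm' e v := S.symm' e fun i => (v i).comp (φ : V →L[ℝ] W)

/-- The `GL(V)`-orbit of a tensor. -/
def orbit (S : SymTensor k V) : Set (SymTensor k V) := {S' | ∃ g : V ≃L[ℝ] V, S' = S.push g}

end SymTensor

/-- The homogeneous function `ξ ↦ S(ξ, …, ξ)` on the dual of `ℝⁿ`, the covector
`ξ₁ e¹ + ⋯ + ξ_n eⁿ` being identified with the coordinate vector `(ξ₁, …, ξ_n)`. -/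
def SymTensor.form {k n : ℕ} (S : SymTensor k (EuclideanSpace ℝ (Fin n))) (ξ : Fin n → ℝ) : ℝ :=
  S.toMul fun _ => ∑ j, ξ j • (EuclideanSpace.proj j : EuclideanSpace ℝ (Fin n) →L[ℝ] ℝ)

/-! ### Regular homogeneous forms -/

/-- Homogeneous polynomial functions of degree `k` in `n` real variables. -/
def IsHomogeneousForm (k : ℕ) {n : ℕ} (h : (Fin n → ℝ) → ℝ) : Prop :=
  ∃ p : MvPolynomial (Fin n) ℝ, p.IsHomogeneous k ∧ ∀ x, h x = MvPolynomial.eval x p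

/-- Names of the coordinates of the space of 3-jets of functions on `ℝⁿ`: the base coordinates
`x_i`, and `u_{s₁…s_l}` with `l ≤ 3`. -/
abbrev JetCoord (n : ℕ) : Type := Fin n ⊕ (Σ l : Fin 4, (Fin (l : ℕ) → Fin n))

/-- The coordinates of the 3-jet of `h` at `x`:
`u_{s₁…s_l} = ∂^l h / ∂x_{s₁} ⋯ ∂x_{s_l} (x)`. -/
def jet3 {n : ℕ} (h : (Fin n → ℝ) → ℝ) (x : Fin n → ℝ) : JetCoord n → ℝ
  | Sum.inl i => x i
  | Sum.inr ⟨l, s⟩ => iteratedFDeriv ℝ (l : ℕ) h x fun j => Pi.single (s j) 1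

/-- Rational differential `GL(n)`-invariants of order at most 3 of homogeneous forms of degree `k`:
rational functions `num / den` on the bundle of 3-jets, at points `x ≠ 0`, of forms of degree `k`,
invariant under the action `j₃(h)(x) ↦ j₃(h ∘ g⁻¹)(g x)` of `GL(n)`. -/
structure RationalInvariant (k n : ℕ) where
  num : MvPolynomial (JetCoord n) ℝ
  den : MvPolynomial (JetCoord n) ℝ
  den_ne_zero : ∃ (h : (Fin n → ℝ) → ℝ) (x : Fin n → ℝ), IsHomogeneousForm k h ∧ x ≠ 0 ∧
    MvPolynomial.eval (jet3 h x) den ≠ 0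
  invariant : ∀ h : (Fin n → ℝ) → ℝ, IsHomogeneousForm k h → ∀ x : Fin n → ℝ, x ≠ 0 →
    ∀ g : (Fin n → ℝ) ≃ₗ[ℝ] (Fin n → ℝ),
      MvPolynomial.eval (jet3 (fun y => h (g.symm y)) (g x)) num * MvPolynomial.eval (jet3 h x) den
        = MvPolynomial.eval (jet3 h x) num *
          MvPolynomial.eval (jet3 (fun y => h (g.symm y)) (g x)) den

/-- The value `J(h)` of a rational invariant on a form, as a function of the point. -/
def RationalInvariant.value {k n : ℕ} (J : RationalInvariant k n) (h : (Fin n → ℝ) → ℝ)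
    (x : Fin n → ℝ) : ℝ :=
  MvPolynomial.eval (jet3 h x) J.num / MvPolynomial.eval (jet3 h x) J.den

/-- Regularity of the 3-jet of `h` at `x`: `h(x) ≠ 0`, the Hessian is non-degenerate, and, with `B`
and `C` the restrictions of the second and third differentials of `h` at `x` to the kernel of
`dh_x`, the vectors `e₁ = l, e₂ = Φ l, …, e_{n-1} = Φ^{n-2} l` are linearly independent. Here `l` is
the `B`-dual of the `B`-trace of `C`, and `B(Φ Y, Z) = C(l, Y, Z)`.
As `B` is non-degenerate, `A` and `l` below exist and are unique, and `Φ = A l`.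
(Normalising factors of the differentials only rescale the `e_i`.) -/
def RegularJet3 {n : ℕ} (h : (Fin n → ℝ) → ℝ) (x : Fin n → ℝ) : Prop :=
  h x ≠ 0 ∧
  (∀ v, (∀ w, iteratedFDeriv ℝ 2 h x ![v, w] = 0) → v = 0) ∧
  ∃ (A : LinearMap.ker (fderiv ℝ h x : (Fin n → ℝ) →ₗ[ℝ] ℝ) →
        Module.End ℝ (LinearMap.ker (fderiv ℝ h x : (Fin n → ℝ) →ₗ[ℝ] ℝ)))
    (l : LinearMap.ker (fderiv ℝ h x : (Fin n → ℝ) →ₗ[ℝ] ℝ)),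
    (∀ X Y Z : LinearMap.ker (fderiv ℝ h x : (Fin n → ℝ) →ₗ[ℝ] ℝ),
      iteratedFDeriv ℝ 2 h x ![(A X Y : Fin n → ℝ), Z]
        = iteratedFDeriv ℝ 3 h x ![(X : Fin n → ℝ), Y, Z]) ∧
    (∀ X : LinearMap.ker (fderiv ℝ h x : (Fin n → ℝ) →ₗ[ℝ] ℝ),
      iteratedFDeriv ℝ 2 h x ![(l : Fin n → ℝ), X] = LinearMap.trace ℝ _ (A X)) ∧
    LinearIndependent ℝ fun i : Fin (n - 1) => (A l ^ (i : ℕ)) l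

/-- A homogeneous form is regular if its 4-jet is regular at some point `x ≠ 0`: the 3-jet at `x` is
regular, and there are invariants `J₁, …, J_{n-1}` of order at most 3, defined there, which together
with `J_n = u` (the invariant `h ↦ h`) satisfy `dJ₁(h) ∧ ⋯ ∧ dJ_n(h) ≠ 0` at `x`. -/
def IsRegularForm (k : ℕ) {n : ℕ} (h : (Fin n → ℝ) → ℝ) : Prop :=
  IsHomogeneousForm k h ∧ ∃ x : Fin n → ℝ, x ≠ 0 ∧ RegularJet3 h x ∧
    ∃ J : Fin (n - 1) → RationalInvariant k n,
      (∀ i, MvPolynomial.eval (jet3 h x) (J i).den ≠ 0) ∧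
      LinearIndependent ℝ (Sum.elim (fun i : Fin (n - 1) => fderiv ℝ ((J i).value h) x)
        (fun _ : Unit => fderiv ℝ h x))

/-- Regular `GL(n)`-orbits in `S^k ℝⁿ`: the orbits of regular forms. -/
def IsRegularOrbit {k n : ℕ} (ϖ : Set (SymTensor k (EuclideanSpace ℝ (Fin n)))) : Prop :=
  ∃ S : SymTensor k (EuclideanSpace ℝ (Fin n)), IsRegularForm k S.form ∧ ϖ = S.orbit

/-! ### Tensor fields and connections on a manifold -/

section Manifold

variable {n k : ℕ} {M : Type*} [TopologicalSpace M] [ChartedSpace (EuclideanSpace ℝ (Fin n)) M]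

/-- Differential 1-forms (no smoothness imposed). -/
abbrev OneForm (n : ℕ) (M : Type*) [TopologicalSpace M]
    [ChartedSpace (EuclideanSpace ℝ (Fin n)) M] : Type _ :=
  ∀ x : M, TangentSpace (𝓡 n) x →L[ℝ] ℝ

/-- Affine connections: covariant derivatives on the tangent bundle, `∇_X Y` at `x` being written
`cov Y x (X x)`. -/
abbrev Connection (n : ℕ) (M : Type*) [TopologicalSpace M]
    [ChartedSpace (EuclideanSpace ℝ (Fin n)) M] [IsManifold (𝓡 n) ∞ M] : Type _ :=
  CovariantDerivative (𝓡 n) (EuclideanSpace ℝ (Fin n)) (TangentSpace (𝓡 n) : M → Type _)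

variable [IsManifold (𝓡 n) ∞ M]

/-- The vector field `Y` is differentiable at `x`. -/
def FieldDiffAt (Y : ∀ x : M, TangentSpace (𝓡 n) x) (x : M) : Prop :=
  MDifferentiableAt (𝓡 n) (𝓡 n).tangent (T% Y) x

/-- A 1-form as a section of the bundle of continuous linear maps `TM → M × ℝ`. -/
def OneForm.toSection (α : OneForm n M) (x : M) :
    TotalSpace (EuclideanSpace ℝ (Fin n) →L[ℝ] ℝ)
      (fun x : M => TangentSpace (𝓡 n) x →L[ℝ] Bundle.Trivial M ℝ x) :=
  ⟨x, α x⟩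

/-- `α` is differentiable at `x`. -/
def OneForm.DiffAt (α : OneForm n M) (x : M) : Prop :=
  MDifferentiableAt (𝓡 n) ((𝓡 n).prod 𝓘(ℝ, EuclideanSpace ℝ (Fin n) →L[ℝ] ℝ)) α.toSection x

/-- `α` is smooth at `x`. -/
def OneForm.SmoothAt (α : OneForm n M) (x : M) : Prop :=
  ContMDiffAt (𝓡 n) ((𝓡 n).prod 𝓘(ℝ, EuclideanSpace ℝ (Fin n) →L[ℝ] ℝ)) ∞ α.toSection x

theorem OneForm.DiffAt.apply {α : OneForm n M} {x : M} (hα : α.DiffAt x)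
    {Y : ∀ x : M, TangentSpace (𝓡 n) x} (hY : FieldDiffAt Y x) :
    MDifferentiableAt (𝓡 n) 𝓘(ℝ) (fun y => α y (Y y)) x := by
  have h : MDifferentiableAt (𝓡 n) ((𝓡 n).prod 𝓘(ℝ, ℝ))
      (fun m => TotalSpace.mk' ℝ (E := Bundle.Trivial M ℝ) m (α m (Y m))) x :=
    MDifferentiableAt.clm_bundle_apply (F₁ := EuclideanSpace ℝ (Fin n)) hα hY
  exact ((mdifferentiableAt_totalSpace _ _).1 h).2

theorem covDerivOneForm_tensorial (cov : Connection n M) {α : OneForm n M} {x : M}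
    (hα : α.DiffAt x) (X : TangentSpace (𝓡 n) x) :
    TensorialAt (𝓡 n) (EuclideanSpace ℝ (Fin n)) (fun Y : ∀ x : M, TangentSpace (𝓡 n) x =>
      mvfderiv (𝓡 n) (fun y => α y (Y y)) x X - α x (cov Y x X)) x where
  smul {f Y} hf hY := by
    have h1 := mvfderiv_fun_mul hf (hα.apply hY)
    have h2 := cov.isCovariantDerivativeOnUniv.leibniz hY hf
    simp [h2, h1]
    ring
  add {Y Y'} hY hY' := by
    have h1 := mvfderiv_fun_add (hα.apply hY) (hα.apply hY')
    have h2 := cov.isCovariantDerivativeOnUniv.add hY hY'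
    simp [h2, h1]
    ring

open scoped Classical in
/-- The covariant derivative `∇_X α` of a 1-form at `x`,
`(∇_X α)(Y) = X(α(Y)) - α(∇_X Y)` (with value `0` where `α` is not differentiable). -/
def covDerivOneForm (cov : Connection n M) (α : OneForm n M) (x : M) (X : TangentSpace (𝓡 n) x) :
    TangentSpace (𝓡 n) x →L[ℝ] ℝ :=
  if h : α.DiffAt x then TensorialAt.mkHom _ x (covDerivOneForm_tensorial cov h X) else 0

theorem covDerivOneForm_apply (cov : Connection n M) {α : OneForm n M} {x : M}
    (hα : α.DiffAt x) (X : TangentSpace (𝓡 n) x) {Y : ∀ x : M, TangentSpace (𝓡 n) x}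
    (hY : FieldDiffAt Y x) :
    covDerivOneForm cov α x X (Y x)
      = mvfderiv (𝓡 n) (fun y => α y (Y y)) x X - α x (cov Y x X) := by
  rw [covDerivOneForm, dif_pos hα, TensorialAt.mkHom_apply _ hY]

variable (n k M) in
/-- Symbols of degree `k`: smooth sections of `S^k(TM)`. -/
structure Symbol where
  toFun : ∀ x : M, SymTensor k (TangentSpace (𝓡 n) x)
  smooth : ∀ (x : M) (α : Fin k → OneForm n M), (∀ i, (α i).SmoothAt x) →
    ContMDiffAt (𝓡 n) 𝓘(ℝ) ∞ (fun y => (toFun y).toMul fun i => α i y) x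

namespace Symbol

/-- The symbol has constant type `ϖ`. -/
def HasConstantType (σ : Symbol n k M) (ϖ : Set (SymTensor k (EuclideanSpace ℝ (Fin n)))) : Prop :=
  ∀ (x : M) (φ : TangentSpace (𝓡 n) x ≃L[ℝ] EuclideanSpace ℝ (Fin n)), (σ.toFun x).push φ ∈ ϖ

/-- The conformal class `[σ] = {f σ}`, with `f` smooth and nowhere vanishing. -/
def conformalClass (σ : Symbol n k M) : Set (Symbol n k M) :=
  {τ | ∃ f : M → ℝ, ContMDiff (𝓡 n) 𝓘(ℝ) ∞ f ∧ (∀ x, f x ≠ 0) ∧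
    ∀ x, (τ.toFun x).toMul = f x • (σ.toFun x).toMul}

end Symbol

/-- The value at `x` of
`(∇_X σ)(α₁, …, α_k) = X(σ(α₁, …, α_k)) - ∑ i, σ(α₁, …, ∇_X α_i, …, α_k)`. -/
def covDerivSymbol (cov : Connection n M) (σ : Symbol n k M) (α : Fin k → OneForm n M) (x : M)
    (X : TangentSpace (𝓡 n) x) : ℝ :=
  mvfderiv (𝓡 n) (fun y => (σ.toFun y).toMul fun i => α i y) x X
    - ∑ i, (σ.toFun x).toMul
        (Function.update (fun j => α j x) i (covDerivOneForm cov (α i) x X))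

/-- `∇_X σ = η(X) σ` for all tangent vectors `X`. -/
def CovDerivEq (cov : Connection n M) (σ : Symbol n k M) (η : OneForm n M) : Prop :=
  ∀ (x : M) (α : Fin k → OneForm n M), (∀ i, (α i).SmoothAt x) → ∀ X : TangentSpace (𝓡 n) x,
    covDerivSymbol cov σ α x X = η x X * (σ.toFun x).toMul fun i => α i x

/-- Equality of connections: the same value of `∇_X Y` at `x` for every vector field `Y`
differentiable at `x` (the values on other fields carry no information). -/
def SameConnection (cov cov' : Connection n M) : Prop :=
  ∀ (Y : ∀ x : M, TangentSpace (𝓡 n) x) (x : M), FieldDiffAt Y x → cov Y x = cov' Y x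

/-- Smooth connections. -/
def SmoothConnection (cov : Connection n M) : Prop :=
  CovariantDerivative.ContMDiffCovariantDerivative cov ∞

/-- Wagner connections of a symbol: `∇_X σ = 0` for all `X`. -/
def IsWagner (cov : Connection n M) (σ : Symbol n k M) : Prop :=
  SmoothConnection cov ∧ CovDerivEq cov σ 0

/-- A connection preserves the conformal class of `σ` if `∇_X σ` is everywhere proportional
to `σ`. -/
def PreservesConformalClass (cov : Connection n M) (σ : Symbol n k M) : Prop :=
  ∃ η : OneForm n M, CovDerivEq cov σ η

/-- The torsion form `θ(X) = Tr(Y ↦ T(X, Y))`, `T(X, Y) = ∇_X Y - ∇_Y X - [X, Y]`. -/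
def torsionForm (cov : Connection n M) : OneForm n M :=
  fun x =>
    haveI : T2Space (TangentSpace (𝓡 n) x) := inferInstanceAs (T2Space (EuclideanSpace ℝ (Fin n)))
    haveI : FiniteDimensional ℝ (TangentSpace (𝓡 n) x) :=
      inferInstanceAs (FiniteDimensional ℝ (EuclideanSpace ℝ (Fin n)))
    LinearMap.toContinuousLinearMap
      { toFun := fun X => LinearMap.trace ℝ (TangentSpace (𝓡 n) x) (cov.torsion x X).toLinearMap
        map_add' := fun X Y => by simp
        map_smul' := fun c X => by simp }

/-- The connection `(X, Y) ↦ ∇_X Y + η(X) Y`. -/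
def addScalarForm (cov : Connection n M) (η : OneForm n M) : Connection n M :=
  cov.addOneForm fun x =>
    haveI : T2Space (TangentSpace (𝓡 n) x) := inferInstanceAs (T2Space (EuclideanSpace ℝ (Fin n)))
    haveI : FiniteDimensional ℝ (TangentSpace (𝓡 n) x) :=
      inferInstanceAs (FiniteDimensional ℝ (EuclideanSpace ℝ (Fin n)))
    LinearMap.toContinuousLinearMap
      { toFun := fun Y => (η x).smulRight Y
        map_add' := fun Y Y' => by ext1 X; simp
        map_smul' := fun c Y => by ext1 X; simpa using smul_comm (η x X) c Y }

end Manifold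

end ChernConn

end

noncomputable section

namespace ChernConn

/-! ### The infinitesimal stabiliser of a regular form is trivial -/

/-! In a chart a symbol is a smooth map `F` into the tensors over the model space. For a connection
with Christoffel symbols `G`, the equation `∇_X σ = η(X) σ` becomes the pointwise linear equation
`dF(v) + G(v)·F = η(v) F`, where the endomorphism `G(v)` acts infinitesimally on `F` (`Tensor.inf`).
Everything rests on two facts about this action.

Injectivity. If a linear field `B` annihilates a regular form `h`, its flow consists of symmetries
of `h`, so the invariants `J_i(h)` and `h` itself are constant along the flow. Their `n`
differentials are independent near some point, hence `B` vanishes on an open set and so everywhere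
(`IsRegularForm.eq_zero_of_symmetry`). Thus `A ↦ A·F` is injective, and a connection is determined
by its form `η`.

Solvability. For a symbol of constant type `F` takes values in a single orbit, and `dF` must be
shown tangent to that orbit. No submanifold structure on the orbit is needed: the orbit is a
countable union of compact pieces, Baire's theorem gives a dense set of points near which `F` stays
in one piece, and a limiting argument gives tangency there. By injectivity the spaces `End·F` are
the ranges of a smooth family of injective maps, so tangency is a closed condition and holds
everywhere. A smooth left inverse then produces smooth Christoffel symbols
(`Tensor.exists_contDiffAt_inf_eq_neg_fderiv`), and uniqueness glues the local solutions into a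
Wagner connection (`exists_parallel_connection`).

The conformal part is bookkeeping for `∇ ↦ ∇ + η ⊗ id`. The identity acts on degree `k` tensors as
`k`, so `∇τ` gains `kη τ`, while the torsion form gains `(n - 1)η`. The choice `η = -df/(kf)` passes
from a Wagner connection of `σ` to one of `fσ`, and `η = -θ/(n - 1)` removes the torsion form. Two
connections preserving the class differ by such an `η`, so a zero torsion form singles out one of
them (`sameConnection_of_torsionForm_eq_zero`). -/

theorem contDiff_mvPolynomial_eval {ι X : Type*} [NormedAddCommGroup X] [NormedSpace ℝ X]
    {f : X → ι → ℝ} (hf : ∀ i, ContDiff ℝ ∞ fun x => f x i) (p : MvPolynomial ι ℝ) :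
    ContDiff ℝ ∞ fun x => MvPolynomial.eval (f x) p := by
  induction p using MvPolynomial.induction_on with
  | C a => simpa using contDiff_const
  | add p q hp hq => simpa using hp.add hq
  | mul_X p i hp => simpa using hp.mul (hf i)

theorem IsHomogeneousForm.contDiff {k n : ℕ} {h : (Fin n → ℝ) → ℝ} (hh : IsHomogeneousForm k h) :
    ContDiff ℝ ∞ h := by
  obtain ⟨p, -, hp⟩ := hh
  rw [funext hp]
  exact contDiff_mvPolynomial_eval (fun i => contDiff_apply ℝ ℝ i) p

theorem contDiff_jet3 {n : ℕ} {h : (Fin n → ℝ) → ℝ} (hh : ContDiff ℝ ∞ h) (c : JetCoord n) :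
    ContDiff ℝ ∞ fun x => jet3 h x c := by
  rcases c with i | ⟨l, s⟩
  · exact contDiff_apply ℝ ℝ i
  · have h1 : ContDiff ℝ ∞ (iteratedFDeriv ℝ (l : ℕ) h) :=
      hh.iteratedFDeriv_right (m := ∞) (by exact_mod_cast le_top)
    exact (ContinuousMultilinearMap.apply ℝ (fun _ : Fin (l : ℕ) => Fin n → ℝ) ℝ
      (fun j => Pi.single (s j) 1)).contDiff.comp h1

theorem RationalInvariant.contDiffAt_value {k n : ℕ} (J : RationalInvariant k n)
    {h : (Fin n → ℝ) → ℝ} (hh : IsHomogeneousForm k h) {x : Fin n → ℝ}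
    (hx : MvPolynomial.eval (jet3 h x) J.den ≠ 0) : ContDiffAt ℝ ∞ (J.value h) x :=
  (contDiff_mvPolynomial_eval (contDiff_jet3 hh.contDiff) J.num).contDiffAt.div
    (contDiff_mvPolynomial_eval (contDiff_jet3 hh.contDiff) J.den).contDiffAt hx

/-- The value of a rational invariant on `h` is invariant under the symmetries of `h`. -/
theorem RationalInvariant.value_symmetry {k n : ℕ} (J : RationalInvariant k n)
    {h : (Fin n → ℝ) → ℝ} (hh : IsHomogeneousForm k h) {x : Fin n → ℝ} (hx0 : x ≠ 0)
    (g : (Fin n → ℝ) ≃ₗ[ℝ] (Fin n → ℝ)) (hg : ∀ y, h (g.symm y) = h y)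
    (hx : MvPolynomial.eval (jet3 h x) J.den ≠ 0)
    (hgx : MvPolynomial.eval (jet3 h (g x)) J.den ≠ 0) :
    J.value h (g x) = J.value h x := by
  have h1 := J.invariant h hh x hx0 g
  rw [funext hg] at h1
  rw [RationalInvariant.value, RationalInvariant.value, div_eq_div_iff hgx hx, h1]

open NormedSpace in
theorem hasDerivAt_exp_smul_apply {X : Type*} [NormedAddCommGroup X] [NormedSpace ℝ X]
    [CompleteSpace X] (B : X →L[ℝ] X) (x : X) (t : ℝ) :
    HasDerivAt (fun s : ℝ => exp (s • B) x) (B (exp (t • B) x)) t := by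
  have h1 : HasDerivAt (fun s : ℝ => exp (s • B)) (B * exp (t • B)) t :=
    hasDerivAt_exp_smul_const' B t
  simpa using h1.clm_apply (hasDerivAt_const t x)

open NormedSpace in
theorem exp_smul_mul_exp_neg_smul {X : Type*} [NormedAddCommGroup X] [NormedSpace ℝ X]
    [CompleteSpace X] (B : X →L[ℝ] X) (t : ℝ) : exp (t • B) * exp ((-t) • B) = 1 := by
  let : NormedAlgebra ℚ (X →L[ℝ] X) := NormedAlgebra.restrictScalars ℚ ℝ (X →L[ℝ] X)
  rw [← exp_add_of_commute (((Commute.refl B).smul_left _).smul_right _), ← add_smul]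
  simp

open NormedSpace in
/-- The one-parameter group generated by an endomorphism. -/
def expEquiv {X : Type*} [NormedAddCommGroup X] [NormedSpace ℝ X]
    [CompleteSpace X] (B : X →L[ℝ] X) (t : ℝ) : X ≃ₗ[ℝ] X :=
  LinearEquiv.ofLinearMap (exp (t • B) : X →L[ℝ] X) (exp ((-t) • B) : X →L[ℝ] X)
    (by
      ext x
      exact congrArg (fun L : X →L[ℝ] X => L x) (exp_smul_mul_exp_neg_smul B t))
    (by
      ext x
      have := exp_smul_mul_exp_neg_smul B (-t)
      rw [neg_neg] at this
      exact congrArg (fun L : X →L[ℝ] X => L x) this)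

/-- An infinitesimal symmetry of a regular form vanishes. -/
theorem IsRegularForm.eq_zero_of_symmetry {k n : ℕ} (hn : 1 ≤ n) {h : (Fin n → ℝ) → ℝ}
    (hh : IsRegularForm k h) (B : (Fin n → ℝ) →L[ℝ] (Fin n → ℝ))
    (hB : ∀ x, fderiv ℝ h x (B x) = 0) : B = 0 := by
  obtain ⟨hhom, x, hx0, -, J, hden, hli⟩ := hh
  have hsm := hhom.contDiff
  -- The derivative of `h` along an integral curve of the linear field `B` is `dh(B) = 0`.
  have hconst : ∀ (y : Fin n → ℝ) (t : ℝ), h (NormedSpace.exp (t • B) y) = h y := by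
    intro y t
    have hd : ∀ s : ℝ, HasDerivAt (fun s : ℝ => h (NormedSpace.exp (s • B) y)) 0 s := by
      intro s
      have h1 := (hsm.differentiable (by simp) (NormedSpace.exp (s • B) y)).hasFDerivAt.comp_hasDerivAt
        s (hasDerivAt_exp_smul_apply B y s)
      rwa [hB] at h1
    have h2 := is_const_of_deriv_eq_zero (fun s => (hd s).differentiableAt) (fun s => (hd s).deriv) t 0
    simpa using h2
  -- The flow consists of symmetries of `h`, so `J_i(h)` is constant along it for as long as the
  -- denominator stays nonzero, that is, for small times.
  have hval : ∀ y : Fin n → ℝ, y ≠ 0 → (∀ i, MvPolynomial.eval (jet3 h y) (J i).den ≠ 0) →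
      ∀ i, fderiv ℝ ((J i).value h) y (B y) = 0 := by
    intro y hy0 hy i
    have h1 : HasDerivAt (fun s : ℝ => (J i).value h (NormedSpace.exp (s • B) y))
        (fderiv ℝ ((J i).value h) y (B y)) 0 := by
      have h2 := hasDerivAt_exp_smul_apply B y 0
      have h3 : DifferentiableAt ℝ ((J i).value h) (NormedSpace.exp ((0 : ℝ) • B) y) := by
        simpa using ((J i).contDiffAt_value hhom (hy i)).differentiableAt (by simp)
      have h4 := h3.hasFDerivAt.comp_hasDerivAt (0 : ℝ) h2
      simpa [Function.comp_def] using h4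
    have hcont : ContinuousAt (fun s : ℝ =>
        MvPolynomial.eval (jet3 h (NormedSpace.exp (s • B) y)) (J i).den) 0 :=
      ((contDiff_mvPolynomial_eval (contDiff_jet3 hsm) (J i).den).continuous.continuousAt).comp
        (hasDerivAt_exp_smul_apply B y 0).continuousAt
    have hne : ∀ᶠ s : ℝ in nhds 0,
        MvPolynomial.eval (jet3 h (NormedSpace.exp (s • B) y)) (J i).den ≠ 0 :=
      hcont.eventually_ne (by simpa using hy i)
    have h5 : HasDerivAt (fun s : ℝ => (J i).value h (NormedSpace.exp (s • B) y)) 0 0 := by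
      refine (hasDerivAt_const (0 : ℝ) ((J i).value h y)).congr_of_eventuallyEq ?_
      filter_upwards [hne] with s hs
      refine (J i).value_symmetry hhom hy0 (expEquiv B s) (fun z => ?_) (hy i) hs
      exact hconst z (-s)
    exact h1.unique h5
  -- Independence of the `n` differentials is an open condition. Near `x` they therefore span the
  -- whole dual, and all of them kill `B y`.
  have hopen : ∀ᶠ y in nhds x, B y = 0 := by
    have hc : ContinuousAt (fun y => (Sum.elim (fun i : Fin (n - 1) => fderiv ℝ ((J i).value h) y)
        (fun _ : Unit => fderiv ℝ h y))) x := by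
      refine continuousAt_pi.2 ?_
      rintro (i | i)
      · exact (((J i).contDiffAt_value hhom (hden i)).fderiv_right (m := ∞) (by simp)).continuousAt
      · exact ((hsm.contDiffAt).fderiv_right (m := ∞) (by simp)).continuousAt
    have hli' := hc.eventually (isOpen_setOfPred_linearIndependent.mem_nhds hli)
    have hden' : ∀ᶠ y in nhds x, ∀ i, MvPolynomial.eval (jet3 h y) (J i).den ≠ 0 :=
      Filter.eventually_all.2 fun i =>
        ((contDiff_mvPolynomial_eval (contDiff_jet3 hsm)
          (J i).den).continuous.continuousAt).eventually_ne (hden i)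
    filter_upwards [hli', hden', continuousAt_id.eventually_ne hx0] with y hy1 hy2 hy3
    have hy1 : LinearIndependent ℝ (Sum.elim (fun i : Fin (n - 1) => fderiv ℝ ((J i).value h) y)
        (fun _ : Unit => fderiv ℝ h y)) := hy1
    have hspan := hy1.span_eq_top_of_card_eq_finrank' (by
      rw [← LinearMap.toContinuousLinearMap.finrank_eq, Module.finrank_linearMap]
      simp
      omega)
    have hker : ∀ L : (Fin n → ℝ) →L[ℝ] ℝ, L (B y) = 0 := by
      intro L
      have hL : L ∈ Submodule.span ℝ (Set.range (Sum.elim (fun i : Fin (n - 1) =>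
        fderiv ℝ ((J i).value h) y) (fun _ : Unit => fderiv ℝ h y))) := by rw [hspan]; trivial
      induction hL using Submodule.span_induction with
      | mem L hL =>
        obtain ⟨i | i, rfl⟩ := hL
        · exact hval y hy3 hy2 i
        · exact hB y
      | zero => rfl
      | add L L' _ _ h1 h2 => simp [h1, h2]
      | smul c L _ h1 => simp [h1]
    ext i
    exact hker (ContinuousLinearMap.proj i)
  have hx : B x = 0 := hopen.self_of_nhds
  -- A linear map vanishing near `x` is zero: for some small `t ≠ 0`, both `x` and `x + t v` lie in
  -- its kernel.
  ext1 v
  have hlim : Filter.Tendsto (fun t : ℝ => x + t • v) (nhdsWithin 0 {0}ᶜ) (nhds x) := by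
    have : Continuous fun t : ℝ => x + t • v := by fun_prop
    exact (this.tendsto' 0 x (by simp)).mono_left nhdsWithin_le_nhds
  obtain ⟨t, ht, ht0⟩ := ((hlim.eventually hopen).and self_mem_nhdsWithin).exists
  have : t • B v = 0 := by simpa [hx] using ht
  simpa using (smul_eq_zero.1 this).resolve_left ht0

/-! ### Covectors and tensors as elements of normed spaces -/

/-- The covector with the given coordinates. -/
def covec {n : ℕ} : (Fin n → ℝ) →ₗ[ℝ] (EuclideanSpace ℝ (Fin n) →L[ℝ] ℝ) where
  toFun ξ := ∑ j, ξ j • (EuclideanSpace.proj j : EuclideanSpace ℝ (Fin n) →L[ℝ] ℝ)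
  map_add' ξ ξ' := by simp [add_smul, Finset.sum_add_distrib]
  map_smul' c ξ := by simp [mul_smul, Finset.smul_sum]

theorem covec_coord {n : ℕ} (a : EuclideanSpace ℝ (Fin n) →L[ℝ] ℝ) :
    covec (fun j => a (EuclideanSpace.single j 1)) = a := by
  ext v
  have hv : v = ∑ j, v j • EuclideanSpace.single j (1 : ℝ) := by
    ext i; simp [Finset.sum_apply, Pi.single_apply]
  conv_rhs => rw [hv]
  simp [covec, mul_comm]

/-- The dual of a normed space, as a normed space. -/
def Covector (V : Type*) [NormedAddCommGroup V] [NormedSpace ℝ V] : Type _ := V →L[ℝ] ℝ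

namespace Covector

variable {V : Type*} [NormedAddCommGroup V] [NormedSpace ℝ V]

instance : NormedAddCommGroup (Covector V) := inferInstanceAs (NormedAddCommGroup (V →L[ℝ] ℝ))

instance : NormedSpace ℝ (Covector V) := inferInstanceAs (NormedSpace ℝ (V →L[ℝ] ℝ))

instance [FiniteDimensional ℝ V] : FiniteDimensional ℝ (Covector V) :=
  inferInstanceAs (FiniteDimensional ℝ (V →L[ℝ] ℝ))

/-- The identification of the dual with its normed version. -/
def equiv : (V →L[ℝ] ℝ) ≃L[ℝ] Covector V := ContinuousLinearEquiv.refl ℝ (V →L[ℝ] ℝ)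

/-- Evaluation of covectors at a vector. -/
def eval (v : V) : Covector V →L[ℝ] ℝ := ContinuousLinearMap.apply ℝ ℝ v

@[simp] theorem eval_equiv (v : V) (a : V →L[ℝ] ℝ) : eval v (equiv a) = a v := rfl

/-- Precomposition of covectors with an endomorphism. -/
def dualMap : (V →L[ℝ] V) →L[ℝ] Covector V →L[ℝ] Covector V :=
  (ContinuousLinearMap.compL ℝ V V ℝ).flip

theorem dualMap_comp (A B : V →L[ℝ] V) (a : Covector V) :
    dualMap (A.comp B) a = dualMap B (dualMap A a) := rfl

@[simp] theorem dualMap_id (a : Covector V) :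
    dualMap (ContinuousLinearMap.id ℝ V) a = a := rfl

end Covector

/-- Continuous `k`-linear forms on the dual of a normed space. -/
abbrev Tensor (k : ℕ) (V : Type*) [NormedAddCommGroup V] [NormedSpace ℝ V] : Type _ :=
  ContinuousMultilinearMap ℝ (fun _ : Fin k => Covector V) ℝ

instance {k : ℕ} {V : Type*} [NormedAddCommGroup V] [NormedSpace ℝ V] :
    NormedAddCommGroup (Tensor k V) :=
  ContinuousMultilinearMap.normedAddCommGroup'

instance {k : ℕ} {V : Type*} [NormedAddCommGroup V] [NormedSpace ℝ V] :
    NormedSpace ℝ (Tensor k V) :=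
  ContinuousMultilinearMap.normedSpace'

instance {k : ℕ} {V : Type*} [NormedAddCommGroup V] [NormedSpace ℝ V] [FiniteDimensional ℝ V] :
    FiniteDimensional ℝ (Tensor k V) :=
  FiniteDimensional.of_injective
    (ContinuousMultilinearMap.toMultilinearMapLinear (R' := ℝ) (A := ℝ)
      (M₁ := fun _ : Fin k => Covector V) (M₂ := ℝ))
    ContinuousMultilinearMap.toMultilinearMap_injective

/-- The multilinear form `(a₁, …, a_k) ↦ ∏ i, a_i (e_{I i})`. -/
def monomialTensor {k n : ℕ} (I : Fin k → Fin n) : Tensor k (EuclideanSpace ℝ (Fin n)) :=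
  (ContinuousMultilinearMap.mkPiAlgebra ℝ (Fin k) ℝ).compContinuousLinearMap fun i =>
    Covector.eval (EuclideanSpace.single (I i) (1 : ℝ))

/-- The tensor with the given components. -/
def tensorOfComponents {k n : ℕ} (m : (Fin k → Fin n) → ℝ) :
    Tensor k (EuclideanSpace ℝ (Fin n)) :=
  ∑ I, m I • monomialTensor I

/-- The tensor with the components of a multilinear form. -/
def toTensor {k n : ℕ}
    (m : MultilinearMap ℝ (fun _ : Fin k => EuclideanSpace ℝ (Fin n) →L[ℝ] ℝ) ℝ) :
    Tensor k (EuclideanSpace ℝ (Fin n)) :=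
  tensorOfComponents fun I => m fun i => EuclideanSpace.proj (I i)

/-- Expanding every argument in the dual basis shows that the components recover the form. This
moves the algebraic tensors of the statement into a normed space, where calculus is available. -/
theorem toTensor_apply {k n : ℕ}
    (m : MultilinearMap ℝ (fun _ : Fin k => EuclideanSpace ℝ (Fin n) →L[ℝ] ℝ) ℝ)
    (a : Fin k → EuclideanSpace ℝ (Fin n) →L[ℝ] ℝ) :
    toTensor m (fun i => Covector.equiv (a i)) = m a := by
  conv_rhs => rw [← funext fun i => covec_coord (a i)]
  simp only [covec, LinearMap.coe_mk, AddHom.coe_mk]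
  rw [m.map_sum]
  simp [m.map_smul_univ, toTensor, tensorOfComponents, monomialTensor, mul_comm]

theorem toTensor_apply_update {k n : ℕ}
    (m : MultilinearMap ℝ (fun _ : Fin k => EuclideanSpace ℝ (Fin n) →L[ℝ] ℝ) ℝ)
    (a : Fin k → EuclideanSpace ℝ (Fin n) →L[ℝ] ℝ) (i : Fin k)
    (b : EuclideanSpace ℝ (Fin n) →L[ℝ] ℝ) :
    toTensor m (Function.update (fun i => Covector.equiv (a i)) i (Covector.equiv b))
      = m (Function.update a i b) := by
  rw [← toTensor_apply]
  refine congrArg (toTensor m) (funext fun j => ?_)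
  rcases eq_or_ne j i with rfl | hj
  · simp
  · simp [hj]

theorem SymTensor.fderiv_form_apply {k n : ℕ} (S : SymTensor k (EuclideanSpace ℝ (Fin n)))
    (ξ η : Fin n → ℝ) : fderiv ℝ S.form ξ η
      = ∑ i, S.toMul (Function.update (fun _ => covec ξ) i (covec η)) := by
  let c : (Fin n → ℝ) →L[ℝ] Covector (EuclideanSpace ℝ (Fin n)) :=
    LinearMap.toContinuousLinearMap
      ((Covector.equiv (V := EuclideanSpace ℝ (Fin n))).toLinearMap ∘ₗ covec)
  have h0 : HasFDerivAt (fun (ξ : Fin n → ℝ) (_ : Fin k) => c ξ)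
      (ContinuousLinearMap.pi fun _ : Fin k => c) ξ := hasFDerivAt_pi.2 fun _ => c.hasFDerivAt
  have h1 := ((toTensor S.toMul).hasFDerivAt fun _ => c ξ).comp ξ h0
  have h2 : S.form = (fun m => toTensor S.toMul m) ∘
      fun ξ (_ : Fin k) => c ξ := by
    funext ξ
    exact (toTensor_apply S.toMul fun _ => covec ξ).symm
  have h3 : fderiv ℝ S.form ξ = _ := h2 ▸ h1.fderiv
  rw [h3]
  simp only [ContinuousLinearMap.comp_apply, ContinuousMultilinearMap.linearDeriv_apply]
  exact Finset.sum_congr rfl fun i _ => toTensor_apply_update S.toMul (fun _ => covec ξ) i (covec η)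

/-- The infinitesimal stabiliser of a regular tensor is trivial. -/
theorem SymTensor.eq_zero_of_infinitesimal_symmetry {k n : ℕ} (hn : 1 ≤ n)
    (S : SymTensor k (EuclideanSpace ℝ (Fin n))) (hS : IsRegularForm k S.form)
    (A : EuclideanSpace ℝ (Fin n) →L[ℝ] EuclideanSpace ℝ (Fin n))
    (hA : ∀ a : Fin k → EuclideanSpace ℝ (Fin n) →L[ℝ] ℝ,
      ∑ i, S.toMul (Function.update a i ((a i).comp A)) = 0) : A = 0 := by
  -- The transpose of `A`, in coordinates on the dual; it is the linear field by which `A` acts on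
  -- the form of `S`.
  let B : (Fin n → ℝ) →ₗ[ℝ] (Fin n → ℝ) :=
    { toFun := fun ξ j => covec ξ (A (EuclideanSpace.single j 1))
      map_add' := fun ξ η => by ext; simp
      map_smul' := fun c ξ => by ext; simp }
  have hB : ∀ ξ, covec (B ξ) = (covec ξ).comp A := fun ξ => covec_coord ((covec ξ).comp A)
  have h0 : LinearMap.toContinuousLinearMap B = 0 := by
    -- Only the diagonal case, all arguments equal to `ξ`, is needed: there the hypothesis is the
    -- derivative of the form along `B`.
    refine hS.eq_zero_of_symmetry hn _ fun ξ => ?_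
    rw [S.fderiv_form_apply]
    simpa [hB] using hA fun _ => covec ξ
  ext v i
  have h1 := hB (Pi.single i 1)
  have h2 : B (Pi.single i 1) = 0 := congrArg (fun L : _ →L[ℝ] _ => L (Pi.single i 1)) h0
  rw [h2, map_zero] at h1
  have h3 := congrArg (fun L : _ →L[ℝ] ℝ => L v) h1
  simp [covec, Pi.single_apply] at h3
  simpa using h3.symm


/-! ### The action of endomorphisms on tensors -/

section MultilinearAction

variable {k : ℕ} {D : Type*} [NormedAddCommGroup D] [NormedSpace ℝ D]

/-- The derivative at the identity of the action of `End D` on `k`-linear forms. -/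
def infAction (S : ContinuousMultilinearMap ℝ (fun _ : Fin k => D) ℝ) :
    (D →L[ℝ] D) →L[ℝ] ContinuousMultilinearMap ℝ (fun _ : Fin k => D) ℝ :=
  (S.fderivCompContinuousLinearMap fun _ : Fin k => ContinuousLinearMap.id ℝ D).comp
    (ContinuousLinearMap.pi fun _ : Fin k => ContinuousLinearMap.id ℝ (D →L[ℝ] D))

theorem infAction_apply (S : ContinuousMultilinearMap ℝ (fun _ : Fin k => D) ℝ)
    (A : D →L[ℝ] D) (a : Fin k → D) :
    infAction S A a = ∑ i, S (Function.update a i (A (a i))) := by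
  simp only [infAction, ContinuousLinearMap.comp_apply,
    ContinuousMultilinearMap.fderivCompContinuousLinearMap_apply]
  refine Finset.sum_congr rfl fun i _ => congrArg S (funext fun j => ?_)
  rcases eq_or_ne j i with rfl | hj
  · simp
  · simp [hj]

theorem hasFDerivAt_compContinuousLinearMap_const
    (S : ContinuousMultilinearMap ℝ (fun _ : Fin k => D) ℝ) :
    HasFDerivAt (fun g : D →L[ℝ] D => S.compContinuousLinearMap fun _ => g) (infAction S)
      (ContinuousLinearMap.id ℝ D) := by
  have h := HasFDerivAt.continuousMultilinearMapCompContinuousLinearMap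
    (hasFDerivAt_const S (ContinuousLinearMap.id ℝ D))
    (fun _ : Fin k => hasFDerivAt_id (𝕜 := ℝ) (ContinuousLinearMap.id ℝ D))
  simpa [infAction] using! h

end MultilinearAction

section Action

variable {k : ℕ} {V : Type*} [NormedAddCommGroup V] [NormedSpace ℝ V]

/-- The tensor `(a₁, …, a_k) ↦ S(a₁ ∘ g, …, a_k ∘ g)`. -/
def Tensor.act (S : Tensor k V) (g : V →L[ℝ] V) : Tensor k V :=
  S.compContinuousLinearMap fun _ => Covector.dualMap g

@[simp] theorem Tensor.act_apply (S : Tensor k V) (g : V →L[ℝ] V) (a : Fin k → Covector V) :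
    S.act g a = S fun i => Covector.dualMap g (a i) := rfl

@[simp] theorem Tensor.act_id (S : Tensor k V) : S.act (ContinuousLinearMap.id ℝ V) = S := rfl

/-- The infinitesimal action of endomorphisms on a tensor. -/
def Tensor.inf (S : Tensor k V) : (V →L[ℝ] V) →L[ℝ] Tensor k V :=
  (infAction S).comp Covector.dualMap

theorem Tensor.inf_apply (S : Tensor k V) (A : V →L[ℝ] V) (a : Fin k → Covector V) :
    S.inf A a = ∑ i, S (Function.update a i (Covector.dualMap A (a i))) :=
  infAction_apply S (Covector.dualMap A) a

theorem Tensor.hasFDerivAt_act (S : Tensor k V) :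
    HasFDerivAt S.act S.inf (ContinuousLinearMap.id ℝ V) := by
  have h : HasFDerivAt (fun g : Covector V →L[ℝ] Covector V =>
      S.compContinuousLinearMap fun _ => g) (infAction S)
      (Covector.dualMap (ContinuousLinearMap.id ℝ V)) := hasFDerivAt_compContinuousLinearMap_const S
  exact h.comp (ContinuousLinearMap.id ℝ V) (Covector.dualMap (V := V)).hasFDerivAt

theorem Tensor.continuous_act (S : Tensor k V) : Continuous S.act := by
  have h : Continuous fun g : Covector V →L[ℝ] Covector V =>
      S.compContinuousLinearMap fun _ => g :=
    ((ContinuousMultilinearMap.compContinuousLinearMapContinuousMultilinear ℝ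
      (fun _ : Fin k => Covector V) (fun _ : Fin k => Covector V) ℝ).cont.comp
        (continuous_pi fun _ => continuous_id)).clm_apply continuous_const
  exact h.comp (Covector.dualMap (V := V)).continuous

/-- Each of the `k` slots contributes one copy of `S`; this is the origin of the factor `k` in the
conformal formulas. -/
theorem Tensor.inf_id (S : Tensor k V) : S.inf (ContinuousLinearMap.id ℝ V) = (k : ℝ) • S := by
  ext a
  simp [Tensor.inf_apply]

theorem Tensor.inf_add (S S' : Tensor k V) : (S + S').inf = S.inf + S'.inf := by
  ext A a; simp [Tensor.inf_apply, Finset.sum_add_distrib]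

theorem Tensor.inf_smul (c : ℝ) (S : Tensor k V) : (c • S).inf = c • S.inf := by
  ext A a; simp [Tensor.inf_apply, Finset.mul_sum]

theorem Tensor.act_act (S : Tensor k V)
    (g h : V →L[ℝ] V) :
    (S.act g).act h = S.act (h.comp g) := rfl

/-- Infinitesimal stabilisers along an orbit are conjugate: if `A` kills `S.act g`, then `g⁻¹ A g`
kills `S`. -/
theorem Tensor.inf_act_injective {S : Tensor k V} (hS : Function.Injective S.inf)
    {g g' : V →L[ℝ] V}
    (hg : g.comp g' = .id ℝ V) (hg' : g'.comp g = .id ℝ V) : Function.Injective (S.act g).inf := by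
  rw [injective_iff_map_eq_zero] at hS ⊢
  intro A hA
  have h0 : g'.comp (A.comp g) = 0 := by
    refine hS _ ?_
    ext a
    have h1 := congrArg (fun T : Tensor k V => T fun i => Covector.dualMap g' (a i)) hA
    have h2 : ∀ i, Covector.dualMap g (Covector.dualMap g' (a i)) = a i := fun i => by
      rw [← Covector.dualMap_comp, hg', Covector.dualMap_id]
    have h3 : ∀ i, (fun j => Covector.dualMap g (Function.update
        (fun i => Covector.dualMap g' (a i)) i
        (Covector.dualMap A (Covector.dualMap g' (a i))) j))
        = Function.update a i (Covector.dualMap (g'.comp (A.comp g)) (a i)) := by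
      intro i; funext j
      rcases eq_or_ne j i with rfl | hj
      · simp [Covector.dualMap_comp]
      · simp [hj, h2]
    simpa [Tensor.inf_apply, h3] using h1
  have h4 : A = g.comp ((g'.comp (A.comp g)).comp g') := by
    have : g.comp ((g'.comp (A.comp g)).comp g') = (g.comp g').comp (A.comp (g.comp g')) := rfl
    rw [this, hg]; rfl
  rw [h4, h0]; simp

end Action

/-! ### Smooth families of tensors in one orbit -/

section Orbit

variable {k : ℕ} {V : Type*} [NormedAddCommGroup V] [NormedSpace ℝ V]

/-- The orbit of a tensor under invertible endomorphisms. -/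
def Tensor.orbit (S : Tensor k V) : Set (Tensor k V) :=
  {T | ∃ g g' : V →L[ℝ] V, g.comp g' = .id ℝ V ∧ g'.comp g = .id ℝ V ∧ T = S.act g}

theorem Tensor.inf_injective_of_mem_orbit {S T : Tensor k V} (hS : Function.Injective S.inf)
    (hT : T ∈ S.orbit) : Function.Injective T.inf := by
  obtain ⟨g, g', h, h', rfl⟩ := hT
  exact Tensor.inf_act_injective hS h h'

open Filter Topology Asymptotics in
/-- If `Ψ(h i) = c(t i)` with `h i → x`, `t i → 0`, and `Ψ` has an injective derivative at `x`, then
`c'(0)` is in the range of this derivative. -/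
theorem deriv_mem_range_of_tendsto {X Y : Type*} [NormedAddCommGroup X] [NormedSpace ℝ X]
    [FiniteDimensional ℝ X] [NormedAddCommGroup Y] [NormedSpace ℝ Y]
    {Ψ : X → Y} {L : X →L[ℝ] Y} {x : X} (hΨ : HasFDerivAt Ψ L x) (hL : Function.Injective L)
    {c : ℝ → Y} {c' : Y} (hc : HasDerivAt c c' 0) {ι : Type*} {l : Filter ι} [l.NeBot]
    {h : ι → X} {t : ι → ℝ} (hh : Tendsto h l (𝓝 x)) (ht : Tendsto t l (𝓝[≠] 0))
    (h0 : Ψ x = c 0) (heq : ∀ i, Ψ (h i) = c (t i)) : c' ∈ L.range := by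
  -- An injective linear map out of a finite-dimensional space is bounded below. This forces `h i -
  -- x = O(t i)`, so the first-order remainder of `Ψ` is negligible against `t i`.
  obtain ⟨K, -, hK⟩ := L.toLinearMap.exists_antilipschitzWith (LinearMap.ker_eq_bot.2 hL)
  have hK' : AntilipschitzWith K L := hK
  have ht0 : Tendsto t l (𝓝 0) := ht.mono_right nhdsWithin_le_nhds
  have hne : ∀ᶠ i in l, t i ≠ 0 := ht.eventually self_mem_nhdsWithin
  have e1 : (fun i => c (t i) - c 0 - t i • c') =o[l] t := by
    have := hc.isLittleO.comp_tendsto ht0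
    simpa [Function.comp_def] using this
  have e2 : (fun i => c (t i) - c 0) =O[l] t := by
    have h1 : (fun i => t i • c') =O[l] t := by
      refine IsBigO.of_bound ‖c'‖ (Eventually.of_forall fun i => ?_)
      rw [norm_smul, mul_comm]
    simpa using e1.isBigO.add h1
  have e3 : (fun i => h i - x) =O[l] t := by
    refine IsBigO.trans ?_ e2
    have h1 : (fun y => y - x) =O[𝓝 x] fun y => Ψ y - Ψ x := by
      have := (hΨ.isTheta_sub (hK'.isUniformInducing L.uniformContinuous).isInducing).2
      exact this
    have := h1.comp_tendsto hh
    simpa [Function.comp_def, heq, h0] using this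
  have e4 : (fun i => c (t i) - c 0 - L (h i - x)) =o[l] t := by
    have := hΨ.isLittleO.comp_tendsto hh
    refine IsLittleO.trans_isBigO ?_ e3
    simpa [Function.comp_def, heq, h0] using this
  have e5 : (fun i => L (h i - x) - t i • c') =o[l] t := by
    simpa using e1.sub e4
  have e6 : Tendsto (fun i => (t i)⁻¹ • L (h i - x)) l (𝓝 c') := by
    have h1 : Tendsto (fun i => (t i)⁻¹ • (L (h i - x) - t i • c')) l (𝓝 0) :=
      e5.tendsto_inv_smul_nhds_zero
    have h2 := h1.add_const c'
    rw [zero_add] at h2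
    refine h2.congr' ?_
    filter_upwards [hne] with i hi
    rw [smul_sub, smul_smul, inv_mul_cancel₀ hi, one_smul, sub_add_cancel]
  -- `c'` is the limit of the vectors `L ((h i - x) / t i)`, and a finite-dimensional range is
  -- closed.
  have hclosed : IsClosed (L.range : Set Y) := Submodule.closed_of_finiteDimensional _
  exact hclosed.mem_of_tendsto e6 (Eventually.of_forall fun i =>
    L.range.smul_mem _ ⟨h i - x, rfl⟩)

open Filter Topology in
/-- The derivative of a map into an orbit is tangent to the orbit, provided that the group
elements can be chosen in a compact set. -/
theorem fderiv_mem_range_inf_of_isCompact [FiniteDimensional ℝ V] {S : Tensor k V}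
    (hS : Function.Injective S.inf) {X : Type*} [NormedAddCommGroup X] [NormedSpace ℝ X]
    {F : X → Tensor k V} {C : Set ((V →L[ℝ] V) × (V →L[ℝ] V))} (hC : IsCompact C)
    (hC' : ∀ g ∈ C, g.1.comp g.2 = .id ℝ V ∧ g.2.comp g.1 = .id ℝ V) {z : X}
    (hF : DifferentiableAt ℝ F z) (hz : ∀ᶠ y in 𝓝 z, ∃ g ∈ C, F y = S.act g.1) (v : X) :
    fderiv ℝ F z v ∈ (F z).inf.range := by
  have hlim : Tendsto (fun t : ℝ => z + t • v) (𝓝[≠] 0) (𝓝 z) := by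
    have : Continuous fun t : ℝ => z + t • v := by fun_prop
    exact (this.tendsto' 0 z (by simp)).mono_left nhdsWithin_le_nhds
  obtain ⟨t, ht⟩ := exists_seq_tendsto (𝓝[≠] (0 : ℝ))
  obtain ⟨N, hN⟩ := eventually_atTop.1 ((hlim.comp ht).eventually hz)
  have hN' : ∀ i, ∃ g ∈ C, F (z + t (i + N) • v) = S.act g.1 := fun i => hN _ (by omega)
  choose g hgC hg using hN'
  -- Compactness provides a limit `g₀`. Since `C` consists of pairs (element, inverse), the limit is
  -- again invertible.
  obtain ⟨g₀, hg₀, φ, hφ, hφg⟩ := hC.tendsto_subseq hgC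
  have ht' : Tendsto (fun i => t (φ i + N)) atTop (𝓝[≠] 0) :=
    ht.comp ((tendsto_add_atTop_nat N).comp hφ.tendsto_atTop)
  have hact : Continuous fun h : V →L[ℝ] V => S.act h := S.continuous_act
  have hz0 : F z = S.act g₀.1 := by
    have h1 : Tendsto (fun i => F (z + t (φ i + N) • v)) atTop (𝓝 (F z)) :=
      hF.continuousAt.tendsto.comp (hlim.comp ht')
    have h2 : Tendsto (fun i => S.act (g (φ i)).1) atTop (𝓝 (S.act g₀.1)) :=
      (hact.tendsto _).comp ((continuous_fst.tendsto _).comp hφg)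
    refine tendsto_nhds_unique h1 (h2.congr fun i => (hg _).symm)
  obtain ⟨hg1, hg2⟩ := hC' _ hg₀
  have hinj : Function.Injective (F z).inf := by
    rw [hz0]; exact Tensor.inf_act_injective hS hg1 hg2
  have hc : HasDerivAt (fun s : ℝ => F (z + s • v)) (fderiv ℝ F z v) 0 := by
    have h1 : HasDerivAt (fun s : ℝ => z + s • v) v 0 := by
      simpa using ((hasDerivAt_id (0 : ℝ)).smul_const v).const_add z
    have h2 : HasFDerivAt F (fderiv ℝ F z) (z + (0 : ℝ) • v) := by simpa using hF.hasFDerivAt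
    exact h2.comp_hasDerivAt 0 h1
  -- Recentred at `F z = S.act g₀`, the group elements become `g_i g₀⁻¹`, which tend to the
  -- identity; the derivative of the action there is `(F z).inf`.
  refine deriv_mem_range_of_tendsto (F z).hasFDerivAt_act hinj hc (l := atTop)
    (h := fun i => (g (φ i)).1.comp g₀.2) (t := fun i => t (φ i + N)) ?_ ht' ?_ ?_
  · have h1 : Continuous fun p : (V →L[ℝ] V) × (V →L[ℝ] V) => p.1.comp g₀.2 := by fun_prop
    have := (h1.tendsto _).comp hφg
    rwa [hg1] at this
  · simp [Tensor.act_id]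
  · intro i
    rw [hg, hz0, Tensor.act_act, ContinuousLinearMap.comp_assoc, hg2]
    rfl

open Filter Topology in
/-- A smooth family of injective linear maps of finite-dimensional spaces locally has a smooth
family of left inverses. -/
theorem exists_contDiffAt_leftInverse {X A B : Type*} [NormedAddCommGroup X] [NormedSpace ℝ X]
    [NormedAddCommGroup A] [NormedSpace ℝ A] [FiniteDimensional ℝ A]
    [NormedAddCommGroup B] [NormedSpace ℝ B] [FiniteDimensional ℝ B]
    {Φ : X → A →L[ℝ] B} {z : X} (hΦ : ContDiffAt ℝ ∞ Φ z) (hz : Function.Injective (Φ z)) :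
    ∃ P : X → B →L[ℝ] A, ContDiffAt ℝ ∞ P z ∧ ∀ᶠ y in 𝓝 z, ∀ a, P y (Φ y a) = a := by
  have : CompleteSpace A := FiniteDimensional.complete ℝ A
  obtain ⟨P₀, hP₀⟩ := ContinuousLinearMap.HasLeftInverse.of_injective_of_finiteDimensional hz
  have hQ : ContDiffAt ℝ ∞ (fun y => P₀.comp (Φ y)) z := contDiffAt_const.clm_comp hΦ
  have hQz : P₀.comp (Φ z) = ((1 : (A →L[ℝ] A)ˣ) : A →L[ℝ] A) := by
    ext a; exact hP₀ a
  -- With `P₀` a left inverse at `z`, the endomorphism `P₀ Φ(y)` equals the identity at `y = z`,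
  -- hence is invertible nearby, and `(P₀ Φ(y))⁻¹ P₀` is a left inverse of `Φ(y)`.
  refine ⟨fun y => (Ring.inverse (P₀.comp (Φ y))).comp P₀, ?_, ?_⟩
  · have h1 : ContDiffAt ℝ ∞ (Ring.inverse : (A →L[ℝ] A) → A →L[ℝ] A) (P₀.comp (Φ z)) := by
      rw [hQz]; exact contDiffAt_ringInverse ℝ 1
    have h2 : ContDiffAt ℝ ∞ (fun y => Ring.inverse (P₀.comp (Φ y))) z :=
      ContDiffAt.comp (g := (Ring.inverse : (A →L[ℝ] A) → A →L[ℝ] A))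
        (f := fun y => P₀.comp (Φ y)) z h1 hQ
    exact h2.clm_comp contDiffAt_const
  · have h1 : ∀ᶠ y in 𝓝 z, IsUnit (P₀.comp (Φ y)) :=
      hQ.continuousAt.eventually (Units.isOpen.mem_nhds ⟨1, hQz.symm⟩)
    filter_upwards [h1] with y hy a
    exact congrArg (fun L : A →L[ℝ] A => L a) (Ring.inverse_mul_cancel _ hy)

open Filter Topology in
/-- Let `inf T : A → Y` be linear in `T` and injective along a smooth map `F`. If the
derivative of `F` at `y` takes values in the range of `inf (F y)` for `y` in a dense set, then
`inf (F y) (G y v) = -dF_y(v)` locally has a smooth solution `G`. -/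
theorem exists_contDiffAt_inf_eq_neg_fderiv {X A Y : Type*}
    [NormedAddCommGroup X] [NormedSpace ℝ X]
    [NormedAddCommGroup A] [NormedSpace ℝ A] [FiniteDimensional ℝ A]
    [NormedAddCommGroup Y] [NormedSpace ℝ Y] [FiniteDimensional ℝ Y]
    (inf : Y → A →L[ℝ] Y) (hadd : ∀ S T, inf (S + T) = inf S + inf T)
    (hsmul : ∀ (c : ℝ) S, inf (c • S) = c • inf S) {F : X → Y} {U : Set X} (hU : IsOpen U)
    (hF : ContDiffOn ℝ ∞ F U) (hinj : ∀ z ∈ U, Function.Injective (inf (F z)))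
    (hfreq : ∀ z ∈ U, ∃ᶠ y in 𝓝 z, ∀ v, ∃ B, inf (F y) B = fderiv ℝ F y v)
    {z : X} (hz : z ∈ U) :
    ∃ G : X → X →L[ℝ] A, ContDiffAt ℝ ∞ G z ∧
      ∀ᶠ y in 𝓝 z, ∀ v, inf (F y) (G y v) = -fderiv ℝ F y v := by
  let L : Y →L[ℝ] A →L[ℝ] Y :=
    LinearMap.toContinuousLinearMap { toFun := inf, map_add' := hadd, map_smul' := hsmul }
  have htan : ∀ y ∈ U, ∀ v, ∃ B, inf (F y) B = fderiv ℝ F y v := by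
    intro y hy v
    have hFy : ContDiffAt ℝ ∞ F y := hF.contDiffAt (hU.mem_nhds hy)
    have hΦ : ContDiffAt ℝ ∞ (fun w => inf (F w)) y := L.contDiff.contDiffAt.comp y hFy
    obtain ⟨P, hP, hPΦ⟩ := exists_contDiffAt_leftInverse hΦ (hinj y hy)
    -- As `P` is a left inverse of `inf (F w)`, the vector `dF_w(v)` is in the range exactly when
    -- this continuous difference vanishes. A nonzero value at `y` would persist nearby, against the
    -- density assumption.
    have hcont : ContinuousAt (fun w => inf (F w) (P w (fderiv ℝ F w v)) - fderiv ℝ F w v) y := by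
      have h1 : ContinuousAt (fun w => fderiv ℝ F w v) y :=
        ((hFy.fderiv_right (m := ∞) (by simp)).continuousAt).clm_apply continuousAt_const
      exact (hΦ.continuousAt.clm_apply (hP.continuousAt.clm_apply h1)).sub h1
    refine ⟨P y (fderiv ℝ F y v), sub_eq_zero.1 ?_⟩
    by_contra hne
    refine hfreq y hy ?_
    filter_upwards [hcont.eventually_ne hne, hPΦ] with w hw1 hw2 hw3
    obtain ⟨B, hB⟩ := hw3 v
    apply hw1
    rw [← hB, hw2, sub_self]
  have hFz : ContDiffAt ℝ ∞ F z := hF.contDiffAt (hU.mem_nhds hz)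
  have hΦ : ContDiffAt ℝ ∞ (fun y => inf (F y)) z := L.contDiff.contDiffAt.comp z hFz
  obtain ⟨P, hP, hPΦ⟩ := exists_contDiffAt_leftInverse hΦ (hinj z hz)
  refine ⟨fun y => -(P y).comp (fderiv ℝ F y),
    (hP.clm_comp (hFz.fderiv_right (m := ∞) (by simp))).neg, ?_⟩
  filter_upwards [hPΦ, hU.mem_nhds hz] with y hy hyU v
  obtain ⟨B, hB⟩ := htan y hyU v
  rw [neg_apply, map_neg, ContinuousLinearMap.comp_apply, ← hB, hy]

open Filter Topology in
/-- The derivative of a smooth map into an orbit is tangent to the orbit on a dense set. -/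
theorem frequently_fderiv_mem_range_inf [FiniteDimensional ℝ V] {S : Tensor k V}
    (hS : Function.Injective S.inf) {X : Type*} [NormedAddCommGroup X] [NormedSpace ℝ X]
    [CompleteSpace X] {F : X → Tensor k V} {U : Set X} (hU : IsOpen U)
    (hF : ContDiffOn ℝ ∞ F U) (hFU : ∀ z ∈ U, F z ∈ S.orbit) {z : X} (hz : z ∈ U) :
    ∃ᶠ y in 𝓝 z, ∀ v, ∃ B, (F y).inf B = fderiv ℝ F y v := by
  have : BaireSpace U := hU.baireSpace
  have : ProperSpace ((V →L[ℝ] V) × (V →L[ℝ] V)) := FiniteDimensional.proper ℝ _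
  -- Bounding the inverse along with the element keeps these sets closed, hence compact; together
  -- they exhaust the general linear group.
  let C : ℕ → Set ((V →L[ℝ] V) × (V →L[ℝ] V)) := fun m =>
    Metric.closedBall 0 m ∩ {g | g.1.comp g.2 = .id ℝ V ∧ g.2.comp g.1 = .id ℝ V}
  have hC : ∀ m, IsCompact (C m) := by
    intro m
    refine (isCompact_closedBall _ _).inter_right ?_
    refine (isClosed_eq ?_ continuous_const).inter (isClosed_eq ?_ continuous_const)
    · exact continuous_fst.clm_comp continuous_snd
    · exact continuous_snd.clm_comp continuous_fst
  let K : ℕ → Set U := fun m => {y : U | F y ∈ (fun g => S.act g.1) '' C m}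
  -- Each piece of the orbit is a continuous image of a compact set, so its preimage under `F` is
  -- closed and Baire's theorem applies to the resulting cover of `U`.
  have hK : ∀ m, IsClosed (K m) := fun m =>
    (((hC m).image (S.continuous_act.comp continuous_fst)).isClosed).preimage
      (hF.continuousOn.domRestrict)
  have hKU : ⋃ m, K m = Set.univ := by
    refine Set.eq_univ_of_forall fun y => ?_
    obtain ⟨g, g', h1, h2, h3⟩ := hFU y y.2
    obtain ⟨m, hm⟩ := exists_nat_ge ‖(g, g')‖
    exact Set.mem_iUnion.2 ⟨m, (g, g'), ⟨by simpa using hm, h1, h2⟩, h3.symm⟩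
  have hdense := dense_iUnion_interior_of_closed hK hKU
  have hgood : ∀ y : U, y ∈ ⋃ m, interior (K m) →
      ∀ v, ∃ B, (F y).inf B = fderiv ℝ F y v := by
    intro y hy v
    obtain ⟨m, hm⟩ := Set.mem_iUnion.1 hy
    refine fderiv_mem_range_inf_of_isCompact hS (hC m) (fun g hg => hg.2)
      ((hF.contDiffAt (hU.mem_nhds y.2)).differentiableAt (by simp)) ?_ v
    have h1 : ∀ᶠ w : U in 𝓝 y, ∃ g ∈ C m, F w = S.act g.1 := by
      filter_upwards [mem_interior_iff_mem_nhds.1 hm] with w hw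
      obtain ⟨g, hg, hg'⟩ := hw
      exact ⟨g, hg, hg'.symm⟩
    rw [← map_nhds_subtype_coe_eq_nhds y.2 (hU.mem_nhds y.2)]
    exact h1
  have h2 : ∃ᶠ y : U in 𝓝 ⟨z, hz⟩, y ∈ ⋃ m, interior (K m) :=
    mem_closure_iff_frequently.1 (hdense ⟨z, hz⟩)
  rw [← map_nhds_subtype_coe_eq_nhds hz (hU.mem_nhds hz)]
  exact (h2.mono hgood : ∃ᶠ y : U in 𝓝 ⟨z, hz⟩, ∀ v, ∃ B, (F y).inf B = fderiv ℝ F y v)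

/-- For a smooth map `F` into the orbit of a tensor with trivial infinitesimal stabiliser, the
equation `G · F = -dF` locally has a smooth solution. -/
theorem Tensor.exists_contDiffAt_inf_eq_neg_fderiv [FiniteDimensional ℝ V] {S : Tensor k V}
    (hS : Function.Injective S.inf) {X : Type*} [NormedAddCommGroup X] [NormedSpace ℝ X]
    [CompleteSpace X] {F : X → Tensor k V} {U : Set X} (hU : IsOpen U)
    (hF : ContDiffOn ℝ ∞ F U) (hFU : ∀ z ∈ U, F z ∈ S.orbit) {z : X} (hz : z ∈ U) :
    ∃ G : X → X →L[ℝ] V →L[ℝ] V, ContDiffAt ℝ ∞ G z ∧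
      ∀ᶠ y in nhds z, ∀ v, (F y).inf (G y v) = -fderiv ℝ F y v :=
  ChernConn.exists_contDiffAt_inf_eq_neg_fderiv Tensor.inf Tensor.inf_add Tensor.inf_smul hU hF
    (fun y hy => Tensor.inf_injective_of_mem_orbit hS (hFU y hy))
    (fun _ hy =>
      frequently_fderiv_mem_range_inf hS hU hF hFU hy) hz

end Orbit


/-! ### Coordinate expressions on a manifold -/

section Coordinates

set_option linter.unusedSectionVars false

variable {n : ℕ} {M : Type*} [TopologicalSpace M] [ChartedSpace (EuclideanSpace ℝ (Fin n)) M]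
  [IsManifold (𝓡 n) ∞ M]

/-- The trivialisation of the tangent bundle given by the chart at `c`. -/
abbrev triv (c : M) : Trivialization (EuclideanSpace ℝ (Fin n))
    (TotalSpace.proj : TotalSpace (EuclideanSpace ℝ (Fin n)) (TangentSpace (𝓡 n) : M → Type _) → M) :=
  trivializationAt (EuclideanSpace ℝ (Fin n)) (TangentSpace (𝓡 n) : M → Type _) c

/-- The components of tangent vectors in the chart at `c`. -/
def coord (c y : M) : TangentSpace (𝓡 n) y →L[ℝ] EuclideanSpace ℝ (Fin n) :=
  (triv c).continuousLinearMapAt ℝ y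

/-- The tangent vectors with given components in the chart at `c`. -/
def fr (c y : M) : EuclideanSpace ℝ (Fin n) →L[ℝ] TangentSpace (𝓡 n) y :=
  (triv c).symmL ℝ y

/-- The domain of the chart at `c`. -/
def dom (n : ℕ) {M : Type*} [TopologicalSpace M] [ChartedSpace (EuclideanSpace ℝ (Fin n)) M]
    (c : M) : Set M :=
  (chartAt (EuclideanSpace ℝ (Fin n)) c).source

theorem isOpen_dom (c : M) : IsOpen (dom n c) := (chartAt _ c).open_source

theorem mem_dom_self (c : M) : c ∈ dom n c := mem_chart_source _ c

theorem dom_eq_baseSet (c : M) : dom n c = (triv (n := n) c).baseSet :=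
  (TangentBundle.trivializationAt_baseSet c).symm

theorem mem_baseSet {c y : M} (hy : y ∈ dom n c) : y ∈ (triv (n := n) c).baseSet :=
  dom_eq_baseSet (n := n) c ▸ hy

theorem coord_fr {c y : M} (hy : y ∈ dom n c) (v : EuclideanSpace ℝ (Fin n)) :
    coord c y (fr c y v) = v :=
  (triv c).continuousLinearMapAt_symmL (mem_baseSet hy) v

theorem fr_coord {c y : M} (hy : y ∈ dom n c) (X : TangentSpace (𝓡 n) y) :
    fr c y (coord c y X) = X :=
  (triv c).symmL_continuousLinearMapAt (mem_baseSet hy) X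

theorem coord_eq_mfderiv {c y : M} (hy : y ∈ dom n c) :
    coord c y = mfderiv (𝓡 n) 𝓘(ℝ, EuclideanSpace ℝ (Fin n)) (extChartAt (𝓡 n) c) y :=
  TangentBundle.continuousLinearMapAt_trivializationAt hy

theorem eventually_coord_eq {c y : M} (hy : y ∈ dom n c) (Y : ∀ x : M, TangentSpace (𝓡 n) x) :
    (fun z => (triv c ⟨z, Y z⟩).2) =ᶠ[nhds y] fun z => coord c z (Y z) := by
  filter_upwards [(isOpen_dom c).mem_nhds hy] with z hz
  rw [dom_eq_baseSet] at hz
  rw [coord, Trivialization.continuousLinearMapAt_apply, Trivialization.coe_linearMapAt_of_mem _ hz]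

theorem fieldDiffAt_iff {c y : M} (hy : y ∈ dom n c) {Y : ∀ x : M, TangentSpace (𝓡 n) x} :
    FieldDiffAt Y y ↔
      MDifferentiableAt (𝓡 n) 𝓘(ℝ, EuclideanSpace ℝ (Fin n)) (fun z => coord c z (Y z)) y := by
  have h := (triv (n := n) c).mdifferentiableAt_section_iff (𝓡 n) Y (mem_baseSet hy)
  refine h.trans ⟨fun h => ?_, fun h => ?_⟩
  · exact h.congr_of_eventuallyEq (eventually_coord_eq hy Y).symm
  · exact h.congr_of_eventuallyEq (eventually_coord_eq hy Y)

theorem contMDiffAt_field_iff {c y : M} (hy : y ∈ dom n c) {Y : ∀ x : M, TangentSpace (𝓡 n) x} :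
    ContMDiffAt (𝓡 n) (𝓡 n).tangent ∞ (T% Y) y ↔
      ContMDiffAt (𝓡 n) 𝓘(ℝ, EuclideanSpace ℝ (Fin n)) ∞ (fun z => coord c z (Y z)) y := by
  have h := (triv (n := n) c).contMDiffAt_section_iff (n := ∞) (IB := 𝓡 n) (s := Y)
    (mem_baseSet hy)
  refine h.trans ⟨fun h => ?_, fun h => ?_⟩
  · exact h.congr_of_eventuallyEq (eventually_coord_eq hy Y).symm
  · exact h.congr_of_eventuallyEq (eventually_coord_eq hy Y)

theorem fieldDiffAt_fr {c y : M} (hy : y ∈ dom n c) (v : EuclideanSpace ℝ (Fin n)) :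
    FieldDiffAt (fun z => fr c z v) y := by
  rw [fieldDiffAt_iff hy]
  refine (mdifferentiableAt_const (c := v)).congr_of_eventuallyEq ?_
  filter_upwards [(isOpen_dom c).mem_nhds hy] with z hz
  exact coord_fr hz v

theorem mvfderiv_coord_fr {c y : M} (hy : y ∈ dom n c) (v : EuclideanSpace ℝ (Fin n)) :
    mvfderiv (𝓡 n) (fun z => coord c z (fr c z v)) y = 0 := by
  have h : (fun z => coord c z (fr c z v)) =ᶠ[nhds y] fun _ => v := by
    filter_upwards [(isOpen_dom c).mem_nhds hy] with z hz
    exact coord_fr hz v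
  have h2 := h.mfderiv_eq (I := 𝓡 n) (I' := 𝓘(ℝ, EuclideanSpace ℝ (Fin n)))
  have h3 : mvfderiv (𝓡 n) (fun z => coord c z (fr c z v)) y
    = mvfderiv (𝓡 n) (fun _ : M => v) y := h2
  rw [h3, mvfderiv_const]

section Derivatives

variable {F G : Type*} [NormedAddCommGroup F] [NormedSpace ℝ F]
  [NormedAddCommGroup G] [NormedSpace ℝ G]

theorem mvfderiv_eq_of_hasMFDerivAt {f : M → F} {y : M} {L : TangentSpace (𝓡 n) y →L[ℝ] F}
    (h : HasMFDerivAt (𝓡 n) 𝓘(ℝ, F) f y L) : mvfderiv (𝓡 n) f y = L :=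
  h.mfderiv

theorem mvfderiv_congr {f g : M → F} {y : M} (h : f =ᶠ[nhds y] g) :
    mvfderiv (𝓡 n) f y = mvfderiv (𝓡 n) g y :=
  h.mfderiv_eq (I := 𝓡 n) (I' := 𝓘(ℝ, F))

theorem mvfderiv_comp_hasFDerivAt {f : M → F} {y : M} {Ψ : F → G} {L : F →L[ℝ] G}
    (hΨ : HasFDerivAt Ψ L (f y)) (hf : MDifferentiableAt (𝓡 n) 𝓘(ℝ, F) f y) :
    mvfderiv (𝓡 n) (fun z => Ψ (f z)) y = L.comp (mvfderiv (𝓡 n) f y) :=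
  mvfderiv_eq_of_hasMFDerivAt (hΨ.hasMFDerivAt.comp y hf.hasMFDerivAt)

theorem mdifferentiableAt_comp_hasFDerivAt {f : M → F} {y : M} {Ψ : F → G} {L : F →L[ℝ] G}
    (hΨ : HasFDerivAt Ψ L (f y)) (hf : MDifferentiableAt (𝓡 n) 𝓘(ℝ, F) f y) :
    MDifferentiableAt (𝓡 n) 𝓘(ℝ, G) (fun z => Ψ (f z)) y :=
  (hΨ.hasMFDerivAt.comp y hf.hasMFDerivAt).mdifferentiableAt

theorem contMDiffAt_chart {c y : M} (hy : y ∈ dom n c) :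
    ContMDiffAt (𝓡 n) 𝓘(ℝ, EuclideanSpace ℝ (Fin n)) ∞ (extChartAt (𝓡 n) c) y :=
  contMDiffAt_extChartAt' hy

theorem eventuallyEq_comp_chart {α : Type*} {c y : M} (hy : y ∈ dom n c) (f : M → α) :
    f =ᶠ[nhds y] fun z => (f ∘ (extChartAt (𝓡 n) c).symm) (extChartAt (𝓡 n) c z) := by
  filter_upwards [(isOpen_dom c).mem_nhds hy] with z hz
  have := (extChartAt (𝓡 n) c).left_inv (by rwa [extChartAt_source])
  simp only [Function.comp_apply]
  rw [this]

theorem contMDiffAt_chart_symm {c y : M} (hy : y ∈ dom n c) :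
    ContMDiffAt 𝓘(ℝ, EuclideanSpace ℝ (Fin n)) (𝓡 n) ∞ (extChartAt (𝓡 n) c).symm
      (extChartAt (𝓡 n) c y) :=
  (contMDiffOn_extChartAt_symm (I := 𝓡 n) (n := ∞) c).contMDiffAt
    ((isOpen_extChartAt_target c).mem_nhds
      ((extChartAt (𝓡 n) c).map_source (by rwa [extChartAt_source])))

theorem chart_symm_chart {c y : M} (hy : y ∈ dom n c) :
    (extChartAt (𝓡 n) c).symm (extChartAt (𝓡 n) c y) = y :=
  (extChartAt (𝓡 n) c).left_inv (by rwa [extChartAt_source])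

/-- The derivative in a chart. -/
theorem mvfderiv_fr_eq_fderiv {c y : M} (hy : y ∈ dom n c) {f : M → F}
    (hf : MDifferentiableAt (𝓡 n) 𝓘(ℝ, F) f y) (v : EuclideanSpace ℝ (Fin n)) :
    mvfderiv (𝓡 n) f y (fr c y v)
      = fderiv ℝ (f ∘ (extChartAt (𝓡 n) c).symm) (extChartAt (𝓡 n) c y) v := by
  have h1 : MDifferentiableAt 𝓘(ℝ, EuclideanSpace ℝ (Fin n)) 𝓘(ℝ, F)
      (f ∘ (extChartAt (𝓡 n) c).symm) (extChartAt (𝓡 n) c y) := by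
    refine MDifferentiableAt.comp (I' := 𝓡 n) _ ?_
      ((contMDiffAt_chart_symm hy).mdifferentiableAt (by simp))
    rwa [chart_symm_chart hy]
  have h2 := h1.differentiableAt.hasFDerivAt
  rw [mvfderiv_congr (eventuallyEq_comp_chart hy f),
    mvfderiv_comp_hasFDerivAt h2 ((contMDiffAt_chart hy).mdifferentiableAt (by simp))]
  have h3 : mvfderiv (𝓡 n) (extChartAt (𝓡 n) c) y = coord c y := (coord_eq_mfderiv hy).symm
  rw [ContinuousLinearMap.comp_apply, h3, coord_fr hy]

theorem contDiffAt_comp_chart_symm {c y : M} (hy : y ∈ dom n c) {f : M → F}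
    (hf : ContMDiffAt (𝓡 n) 𝓘(ℝ, F) ∞ f y) :
    ContDiffAt ℝ ∞ (f ∘ (extChartAt (𝓡 n) c).symm) (extChartAt (𝓡 n) c y) := by
  rw [← contMDiffAt_iff_contDiffAt]
  refine ContMDiffAt.comp (I' := 𝓡 n) _ ?_ (contMDiffAt_chart_symm hy)
  rwa [chart_symm_chart hy]

/-- The chart expression of the differential of a smooth function is smooth. -/
theorem contMDiffAt_mvfderiv_comp_fr {c y : M} (hy : y ∈ dom n c) {f : M → F}
    (hf : ContMDiffAt (𝓡 n) 𝓘(ℝ, F) ∞ f y) :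
    ContMDiffAt (𝓡 n) 𝓘(ℝ, EuclideanSpace ℝ (Fin n) →L[ℝ] F) ∞
      (fun z => (mvfderiv (𝓡 n) f z).comp (fr c z)) y := by
  have h1 := (contDiffAt_comp_chart_symm hy hf).fderiv_right (m := ∞) (by simp)
  have h2 := h1.contMDiffAt.comp y (contMDiffAt_chart hy)
  refine h2.congr_of_eventuallyEq ?_
  have h3 : ∀ᶠ z in nhds y, ContMDiffAt (𝓡 n) 𝓘(ℝ, F) 1 f z :=
    (contMDiffAt_iff_contMDiffAt_nhds (by simp)).1 (hf.of_le (by simp))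
  filter_upwards [h3, (isOpen_dom c).mem_nhds hy] with z hz hz'
  ext v
  exact mvfderiv_fr_eq_fderiv hz' (hz.mdifferentiableAt (by simp)) v

end Derivatives

end Coordinates

/-! ### Smoothness of the trace and of the antisymmetrisation of bilinear maps -/

section Trace

variable (V : Type*) [NormedAddCommGroup V] [NormedSpace ℝ V] [FiniteDimensional ℝ V]

/-- The trace as a continuous linear map. -/
def traceCLM : (V →L[ℝ] V) →L[ℝ] ℝ :=
  LinearMap.toContinuousLinearMap (LinearMap.trace ℝ V ∘ₗ ContinuousLinearMap.coeLM ℝ)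

end Trace

section Flip

variable {V W : Type*} [NormedAddCommGroup V] [NormedSpace ℝ V]
  [NormedAddCommGroup W] [NormedSpace ℝ W]

theorem contDiff_flip : ContDiff ℝ ∞ fun G : V →L[ℝ] V →L[ℝ] W => G.flip :=
  IsBoundedLinearMap.contDiff
    { map_add := ContinuousLinearMap.flip_add
      map_smul := ContinuousLinearMap.flip_smul
      bound := ⟨1, one_pos, fun G => by simp⟩ }

theorem contDiff_sub_flip : ContDiff ℝ ∞ fun G : V →L[ℝ] V →L[ℝ] W => G - G.flip :=
  contDiff_id.sub contDiff_flip

theorem contDiff_clm_comp (t : W →L[ℝ] ℝ) : ContDiff ℝ ∞ fun L : V →L[ℝ] W => t.comp L :=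
  (ContinuousLinearMap.compL ℝ V W ℝ t).contDiff

theorem contDiff_comp_sub_flip (t : (V →L[ℝ] W) →L[ℝ] ℝ) :
    ContDiff ℝ ∞ fun G : V →L[ℝ] V →L[ℝ] W => t.comp (G - G.flip) :=
  (contDiff_clm_comp t).comp contDiff_sub_flip

theorem comp_sub_flip_add (t : (V →L[ℝ] W) →L[ℝ] ℝ) (G G' : V →L[ℝ] V →L[ℝ] W) :
    t.comp (G + G' - (G + G').flip) = t.comp (G - G.flip) + t.comp (G' - G'.flip) := by
  have h : G + G' - (G + G').flip = (G - G.flip) + (G' - G'.flip) := by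
    rw [ContinuousLinearMap.flip_add]
    abel
  rw [h, ContinuousLinearMap.comp_add]

end Flip

/-! ### Christoffel symbols -/

section Christoffel

set_option linter.unusedSectionVars false

variable {n : ℕ} {M : Type*} [TopologicalSpace M] [ChartedSpace (EuclideanSpace ℝ (Fin n)) M]
  [IsManifold (𝓡 n) ∞ M]

/-- Christoffel symbols at a point, as a bilinear map on the model space. -/
abbrev Christoffel (n : ℕ) : Type :=
  EuclideanSpace ℝ (Fin n) →L[ℝ] EuclideanSpace ℝ (Fin n) →L[ℝ] EuclideanSpace ℝ (Fin n)

instance : NormedAddCommGroup (Christoffel n) := ContinuousLinearMap.toNormedAddCommGroup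

instance : NormedSpace ℝ (Christoffel n) := ContinuousLinearMap.toNormedSpace

/-- `G` is the value at `y` of the Christoffel symbols of `cov` in the chart at `c`. -/
def HasChristoffel (cov : Connection n M) (c y : M) (G : Christoffel n) : Prop :=
  ∀ Y : ∀ x : M, TangentSpace (𝓡 n) x, FieldDiffAt Y y → ∀ X : TangentSpace (𝓡 n) y,
    coord c y (cov Y y X) = mvfderiv (𝓡 n) (fun z => coord c z (Y z)) y X
      + G (coord c y X) (coord c y (Y y))

theorem coord_injective {c y : M} (hy : y ∈ dom n c) {X X' : TangentSpace (𝓡 n) y}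
    (h : coord c y X = coord c y X') : X = X' := by
  rw [← fr_coord hy X, h, fr_coord hy]

/-- The covariant and the coordinate derivative obey the same Leibniz rule, so the terms with `df`
cancel in their difference. -/
theorem christoffel_tensorial (cov : Connection n M) {c y : M} (hy : y ∈ dom n c)
    (X : TangentSpace (𝓡 n) y) :
    TensorialAt (𝓡 n) (EuclideanSpace ℝ (Fin n)) (fun Y : ∀ x : M, TangentSpace (𝓡 n) x =>
      coord c y (cov Y y X) - mvfderiv (𝓡 n) (fun z => coord c z (Y z)) y X) y where
  smul {f Y} hf hY := by
    have h1 := mvfderiv_fun_smul hf ((fieldDiffAt_iff hy).1 hY)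
    have h2 := cov.isCovariantDerivativeOnUniv.leibniz hY hf
    have h3 : (fun z => coord c z ((f • Y) z)) = fun z => f z • coord c z (Y z) := by
      ext1 z; simp
    rw [h3, h2, h1]
    simp
    module
  add {Y Y'} hY hY' := by
    have h1 := mvfderiv_fun_add ((fieldDiffAt_iff hy).1 hY) ((fieldDiffAt_iff hy).1 hY')
    have h2 := cov.isCovariantDerivativeOnUniv.add hY hY'
    have h3 : (fun z => coord c z ((Y + Y') z)) = fun z => coord c z (Y z) + coord c z (Y' z) := by
      ext1 z; simp
    rw [h3, h2, h1]
    simp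
    module

theorem exists_hasChristoffel (cov : Connection n M) {c y : M} (hy : y ∈ dom n c) :
    ∃ G : Christoffel n, HasChristoffel cov c y G := by
  have key (X) {Y : ∀ x : M, TangentSpace (𝓡 n) x} (hY : FieldDiffAt Y y) :=
    TensorialAt.mkHom_apply (christoffel_tensorial cov hy X) hY
  -- Tensoriality gives linearity in the field only. Linearity in `X` is read off on coordinate
  -- frames, whose component derivative vanishes.
  have key2 (X : TangentSpace (𝓡 n) y) (w : EuclideanSpace ℝ (Fin n)) :
      TensorialAt.mkHom _ y (christoffel_tensorial cov hy X) (fr c y w)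
        = coord c y (cov (fun z => fr c z w) y X) := by
    rw [key X (fieldDiffAt_fr hy w), mvfderiv_coord_fr hy]
    simp
  let B : EuclideanSpace ℝ (Fin n) →ₗ[ℝ] EuclideanSpace ℝ (Fin n) →ₗ[ℝ] EuclideanSpace ℝ (Fin n) :=
    LinearMap.mk₂ ℝ
      (fun v w => TensorialAt.mkHom _ y (christoffel_tensorial cov hy (fr c y v)) (fr c y w))
      (fun v v' w => by rw [key2, key2, key2]; simp only [map_add])
      (fun r v w => by rw [key2, key2]; simp only [map_smul])
      (fun v w w' => by simp only [map_add])
      (fun r v w => by simp only [map_smul])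
  refine ⟨B.toContinuousBilinearMap, fun Y hY X => ?_⟩
  have h : B (coord c y X) (coord c y (Y y))
      = TensorialAt.mkHom _ y (christoffel_tensorial cov hy X) (Y y) := by
    simp only [B, LinearMap.mk₂_apply, fr_coord hy]
  rw [LinearMap.toContinuousBilinearMap_apply, h, key X hY]
  abel

theorem HasChristoffel.apply {cov : Connection n M} {c y : M} {G : Christoffel n}
    (hG : HasChristoffel cov c y G) (hy : y ∈ dom n c) (v w : EuclideanSpace ℝ (Fin n)) :
    coord c y (cov (fun z => fr c z w) y (fr c y v)) = G v w := by
  rw [hG _ (fieldDiffAt_fr hy w), mvfderiv_coord_fr hy, coord_fr hy, coord_fr hy]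
  simp

theorem sameConnection_of_christoffel {cov cov' : Connection n M}
    (h : ∀ (x : M) (G G' : Christoffel n), HasChristoffel cov x x G → HasChristoffel cov' x x G' →
      G = G') : SameConnection cov cov' := by
  intro Y x hY
  obtain ⟨G, hG⟩ := exists_hasChristoffel cov (mem_dom_self (n := n) x)
  obtain ⟨G', hG'⟩ := exists_hasChristoffel cov' (mem_dom_self (n := n) x)
  ext1 X
  apply coord_injective (mem_dom_self (n := n) x)
  rw [hG Y hY, hG' Y hY, h x G G' hG hG']

/-- The connection whose Christoffel symbols at `x`, in the chart at `x`, are `Γ x`. -/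
def ofChristoffel (Γ : M → Christoffel n) : Connection n M where
  toFun Y x := (fr x x).comp (mvfderiv (𝓡 n) (fun z => coord x z (Y z)) x
    + ((Γ x).flip (coord x x (Y x))).comp (coord x x))
  isCovariantDerivativeOnUniv :=
    { add := by
        intro Y Y' x hY hY' _
        have hx := mem_dom_self (n := n) x
        have h1 := mvfderiv_fun_add ((fieldDiffAt_iff hx).1 hY) ((fieldDiffAt_iff hx).1 hY')
        have h3 : (fun z => coord x z ((Y + Y') z))
            = fun z => coord x z (Y z) + coord x z (Y' z) := by
          ext1 z; simp
        ext1 X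
        rw [h3, h1]
        simp
        abel
      leibniz := by
        intro Y f x hY hf _
        have hx := mem_dom_self (n := n) x
        have h1 := mvfderiv_fun_smul hf ((fieldDiffAt_iff hx).1 hY)
        have h3 : (fun z => coord x z ((f • Y) z)) = fun z => f z • coord x z (Y z) := by
          ext1 z; simp
        ext1 X
        rw [h3, h1]
        simp [fr_coord hx]
        module }

theorem hasChristoffel_ofChristoffel (Γ : M → Christoffel n) (x : M) :
    HasChristoffel (ofChristoffel Γ) x x (Γ x) := by
  intro Y hY X
  exact coord_fr (mem_dom_self x) _

theorem HasChristoffel.addScalarForm {cov : Connection n M} {c y : M} {G : Christoffel n}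
    (hG : HasChristoffel cov c y G) (hy : y ∈ dom n c) (η : OneForm n M) :
    HasChristoffel (addScalarForm cov η) c y
      (G + ((η y).comp (fr c y)).smulRight (.id ℝ (EuclideanSpace ℝ (Fin n)))) := by
  intro Y hY X
  have h : ChernConn.addScalarForm cov η Y y X = cov Y y X + η y X • Y y := rfl
  rw [h, map_add, hG Y hY, map_smul]
  simp [fr_coord hy, add_assoc]

/-! ### Torsion -/

theorem inverse_coord {c y : M} (hy : y ∈ dom n c) :
    (coord (n := n) c y).inverse = fr c y := by
  let e := (triv (n := n) c).continuousLinearEquivAt ℝ y (mem_baseSet hy)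
  have h1 : (e : TangentSpace (𝓡 n) y →L[ℝ] EuclideanSpace ℝ (Fin n)) = coord c y :=
    ContinuousLinearMap.coeFn_injective
      (Trivialization.coe_continuousLinearEquivAt_eq _ (mem_baseSet hy))
  rw [← h1, ContinuousLinearMap.inverse_equiv]
  exact ContinuousLinearMap.coeFn_injective
    (Trivialization.symm_continuousLinearEquivAt_eq _ (mem_baseSet hy))

/-- Coordinate fields are pull-backs of constant fields under the chart, and pull-back commutes with
the bracket. -/
theorem mlieBracket_fr {c y : M} (hy : y ∈ dom n c) (v w : EuclideanSpace ℝ (Fin n)) :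
    VectorField.mlieBracket (𝓡 n) (fun z => fr c z v) (fun z => fr c z w) y = 0 := by
  let U (u : EuclideanSpace ℝ (Fin n)) :
    ∀ x : EuclideanSpace ℝ (Fin n), TangentSpace 𝓘(ℝ, EuclideanSpace ℝ (Fin n)) x := fun _ => u
  have h (u : EuclideanSpace ℝ (Fin n)) : (fun z => fr c z u) =ᶠ[nhds y]
      VectorField.mpullback (𝓡 n) 𝓘(ℝ, EuclideanSpace ℝ (Fin n)) (extChartAt (𝓡 n) c) (U u) := by
    filter_upwards [(isOpen_dom c).mem_nhds hy] with z hz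
    have h1 : (mfderiv (𝓡 n) 𝓘(ℝ, EuclideanSpace ℝ (Fin n)) (extChartAt (𝓡 n) c) z).inverse
        = fr c z := by
      rw [← coord_eq_mfderiv hz]
      exact inverse_coord hz
    exact (DFunLike.congr_fun h1 u).symm
  have hM : IsManifold (𝓡 n) (minSmoothness ℝ 2) M := by
    rw [minSmoothness_of_isRCLikeNormedField]
    exact IsManifold.of_le (n := ∞) (WithTop.coe_le_coe.2 le_top)
  have hU (u : EuclideanSpace ℝ (Fin n)) (x) : MDifferentiableAt 𝓘(ℝ, EuclideanSpace ℝ (Fin n))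
      𝓘(ℝ, EuclideanSpace ℝ (Fin n)).tangent (T% (U u)) x := by
    have h := contMDiffAt_vectorSpace_iff_contDiffAt (n := 1) (V := U u) (x := x)
    exact (h.2 contDiffAt_const).mdifferentiableAt one_ne_zero
  rw [(h v).mlieBracket_vectorField_eq (h w),
    ← VectorField.mpullback_mlieBracket (n := ∞) (hU v _) (hU w _) (contMDiffAt_chart hy)
      (by rw [minSmoothness_of_isRCLikeNormedField]; exact WithTop.coe_le_coe.2 le_top),
    VectorField.mpullback_apply, ← VectorField.mlieBracketWithin_univ,
    VectorField.mlieBracketWithin_eq_lieBracketWithin, VectorField.lieBracketWithin_univ]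
  have h0 : VectorField.lieBracket ℝ (U v) (U w) (extChartAt (𝓡 n) c y) = 0 := by
    have h1 : fderiv ℝ (U v) (extChartAt (𝓡 n) c y) = 0 := fderiv_const_apply _
    have h2 : fderiv ℝ (U w) (extChartAt (𝓡 n) c y) = 0 := fderiv_const_apply _
    rw [VectorField.lieBracket, h1, h2]
    exact sub_zero _
  rw [h0]
  exact map_zero _

/-- The torsion form in terms of Christoffel symbols. -/
def torsionTrace (G : Christoffel n) : EuclideanSpace ℝ (Fin n) →L[ℝ] ℝ :=
  (traceCLM (EuclideanSpace ℝ (Fin n))).comp (G - G.flip)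

theorem torsionTrace_apply (G : Christoffel n) (v : EuclideanSpace ℝ (Fin n)) :
    torsionTrace G v = LinearMap.trace ℝ (EuclideanSpace ℝ (Fin n)) (G v - G.flip v).toLinearMap :=
  rfl

theorem torsionTrace_add (G G' : Christoffel n) :
    torsionTrace (G + G') = torsionTrace G + torsionTrace G' := by
  exact comp_sub_flip_add _ G G'

theorem contDiff_torsionTrace : ContDiff ℝ ∞ (torsionTrace (n := n)) :=
  contDiff_comp_sub_flip _

/-- The endomorphism `w ↦ b(v) w - b(w) v` has trace `n b(v) - b(v)`. -/
theorem torsionTrace_smulRight_id (b : EuclideanSpace ℝ (Fin n) →L[ℝ] ℝ) :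
    torsionTrace (b.smulRight (.id ℝ (EuclideanSpace ℝ (Fin n)))) = ((n : ℝ) - 1) • b := by
  ext v
  have h : (b.smulRight (ContinuousLinearMap.id ℝ (EuclideanSpace ℝ (Fin n)))).flip v
      = b.smulRight v := by ext; simp
  rw [torsionTrace_apply, h]
  simp [LinearMap.trace_smulRight]
  ring

theorem HasChristoffel.torsion {cov : Connection n M} {c y : M} {G : Christoffel n}
    (hG : HasChristoffel cov c y G) (hy : y ∈ dom n c) (v w : EuclideanSpace ℝ (Fin n)) :
    cov.torsion y (fr c y v) (fr c y w) = fr c y (G v w - G w v) := by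
  apply coord_injective hy
  rw [CovariantDerivative.torsion_apply cov (X := fun z => fr c z v) (Y := fun z => fr c z w)
    (fieldDiffAt_fr hy v) (fieldDiffAt_fr hy w), mlieBracket_fr hy, sub_zero, map_sub,
    hG.apply hy, hG.apply hy, coord_fr hy]

theorem HasChristoffel.torsionForm_comp_fr {cov : Connection n M} {c y : M} {G : Christoffel n}
    (hG : HasChristoffel cov c y G) (hy : y ∈ dom n c) :
    (torsionForm cov y).comp (fr c y) = torsionTrace G := by
  ext v
  have h : (cov.torsion y (fr c y v)).toLinearMap
      = (fr c y).toLinearMap ∘ₗ ((G v - G.flip v).toLinearMap ∘ₗ (coord c y).toLinearMap) := by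
    ext1 X
    have := hG.torsion hy v (coord c y X)
    rw [fr_coord hy] at this
    simpa using this
  have h2 : ((G v - G.flip v).toLinearMap ∘ₗ (coord c y).toLinearMap) ∘ₗ (fr c y).toLinearMap
      = (G v - G.flip v).toLinearMap := by
    ext1 w
    simp [coord_fr hy]
  have : FiniteDimensional ℝ (TangentSpace (𝓡 n) y) :=
    inferInstanceAs (FiniteDimensional ℝ (EuclideanSpace ℝ (Fin n)))
  calc torsionForm cov y (fr c y v)
      = LinearMap.trace ℝ (TangentSpace (𝓡 n) y) (cov.torsion y (fr c y v)).toLinearMap := rfl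
    _ = _ := by
      rw [h, LinearMap.trace_comp_comm', h2]
      rfl

/-! ### Smoothness -/

/-- In the trivialisations at `c`, the section `∇Y` reads `dY + G(·, Y)`, which is smooth when `Y`
and `G` are. -/
theorem smoothConnection_of_christoffel {cov : Connection n M}
    (h : ∀ c : M, ∃ G : M → Christoffel n,
      ContMDiffAt (𝓡 n) 𝓘(ℝ, Christoffel n) ∞ G c ∧ ∀ᶠ y in nhds c, HasChristoffel cov c y (G y)) :
    SmoothConnection cov := by
  refine ⟨⟨fun {Y} hY => ?_⟩⟩
  intro c _
  obtain ⟨G, hG, hcov⟩ := h c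
  have hc := mem_dom_self (n := n) c
  have hYc : ContMDiffAt (𝓡 n) (𝓡 n).tangent ∞ (T% Y) c := by
    have := hY.contMDiffAt (x := c) Filter.univ_mem
    exact this
  have hYd : ∀ᶠ y in nhds c, FieldDiffAt Y y :=
    Filter.Eventually.of_forall fun y => (hY.contMDiffAt (x := y) Filter.univ_mem).mdifferentiableAt
      (by simp)
  have hY' := (contMDiffAt_field_iff hc).1 hYc
  rw [contMDiffWithinAt_univ, contMDiffAt_hom_bundle]
  refine ⟨contMDiffAt_id, ?_⟩
  have h1 := contMDiffAt_mvfderiv_comp_fr hc hY'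
  have h2 : ContMDiffAt (𝓡 n) 𝓘(ℝ, EuclideanSpace ℝ (Fin n) →L[ℝ] EuclideanSpace ℝ (Fin n)) ∞
      (fun z => (G z).flip (coord c z (Y z))) c := by
    refine ContMDiffAt.clm_apply ?_ hY'
    exact (contDiff_flip.contMDiff.contMDiffAt).comp c hG
  refine (h1.add h2).congr_of_eventuallyEq ?_
  filter_upwards [hcov, hYd, (isOpen_dom c).mem_nhds hc] with z hz hYz hzc
  ext1 v
  refine (hz Y hYz (fr c z v)).trans ?_
  rw [coord_fr hzc]
  rfl

end Christoffel

/-! ### Components of symbols -/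

theorem fderiv_multilinear_apply {k : ℕ} {X D : Type*} [NormedAddCommGroup X] [NormedSpace ℝ X]
    [NormedAddCommGroup D] [NormedSpace ℝ D]
    {S : X → ContinuousMultilinearMap ℝ (fun _ : Fin k => D) ℝ} {a : Fin k → X → D} {x : X}
    (hS : DifferentiableAt ℝ S x) (ha : ∀ i, DifferentiableAt ℝ (a i) x) (v : X) :
    fderiv ℝ (fun z => S z fun i => a i z) x v = fderiv ℝ S x v (fun i => a i x)
      + ∑ i, S x (Function.update (fun i => a i x) i (fderiv ℝ (a i) x v)) := by
  have h := HasFDerivAt.continuousMultilinearMap_apply hS.hasFDerivAt fun i => (ha i).hasFDerivAt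
  rw [h.fderiv]
  simp

section Components

set_option linter.unusedSectionVars false

variable {n k : ℕ} {M : Type*} [TopologicalSpace M] [ChartedSpace (EuclideanSpace ℝ (Fin n)) M]
  [IsManifold (𝓡 n) ∞ M]

theorem differentiableAt_comp_chart_symm {F : Type*} [NormedAddCommGroup F] [NormedSpace ℝ F]
    {c y : M} (hy : y ∈ dom n c) {f : M → F} (hf : MDifferentiableAt (𝓡 n) 𝓘(ℝ, F) f y) :
    DifferentiableAt ℝ (f ∘ (extChartAt (𝓡 n) c).symm) (extChartAt (𝓡 n) c y) := by
  refine MDifferentiableAt.differentiableAt (MDifferentiableAt.comp (I' := 𝓡 n) _ ?_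
    ((contMDiffAt_chart_symm hy).mdifferentiableAt (by simp)))
  rwa [chart_symm_chart hy]

theorem mdifferentiableAt_of_comp_chart_symm {F : Type*} [NormedAddCommGroup F] [NormedSpace ℝ F]
    {c y : M} (hy : y ∈ dom n c) {f : M → F}
    (hf : DifferentiableAt ℝ (f ∘ (extChartAt (𝓡 n) c).symm) (extChartAt (𝓡 n) c y)) :
    MDifferentiableAt (𝓡 n) 𝓘(ℝ, F) f y :=
  (mdifferentiableAt_comp_hasFDerivAt hf.hasFDerivAt
    ((contMDiffAt_chart hy).mdifferentiableAt (by simp))).congr_of_eventuallyEq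
      (eventuallyEq_comp_chart hy f)

theorem mvfderiv_multilinear_apply {D : Type*} [NormedAddCommGroup D] [NormedSpace ℝ D]
    {S : M → ContinuousMultilinearMap ℝ (fun _ : Fin k => D) ℝ} {a : Fin k → M → D} {y : M}
    (hS : MDifferentiableAt (𝓡 n) 𝓘(ℝ, ContinuousMultilinearMap ℝ (fun _ : Fin k => D) ℝ) S y)
    (ha : ∀ i, MDifferentiableAt (𝓡 n) 𝓘(ℝ, D) (a i) y) (X : TangentSpace (𝓡 n) y) :
    mvfderiv (𝓡 n) (fun z => S z fun i => a i z) y X = mvfderiv (𝓡 n) S y X (fun i => a i y)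
      + ∑ i, S y (Function.update (fun i => a i y) i (mvfderiv (𝓡 n) (a i) y X)) := by
  have hy := mem_dom_self (n := n) y
  rw [mvfderiv_congr (eventuallyEq_comp_chart hy fun z => S z fun i => a i z),
    ← fr_coord hy X, mvfderiv_fr_eq_fderiv hy hS, Finset.sum_congr rfl fun i _ => by
      rw [mvfderiv_fr_eq_fderiv hy (ha i)]]
  have hS' := differentiableAt_comp_chart_symm hy hS
  have ha' := fun i => differentiableAt_comp_chart_symm hy (ha i)
  have hd : DifferentiableAt ℝ ((fun z => S z fun i => a i z) ∘ (extChartAt (𝓡 n) y).symm)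
      (extChartAt (𝓡 n) y y) :=
    (HasFDerivAt.continuousMultilinearMap_apply hS'.hasFDerivAt
      fun i => (ha' i).hasFDerivAt).differentiableAt
  rw [mvfderiv_comp_hasFDerivAt hd.hasFDerivAt ((contMDiffAt_chart hy).mdifferentiableAt (by simp))]
  have h3 : mvfderiv (𝓡 n) (extChartAt (𝓡 n) y) y = coord y y := (coord_eq_mfderiv hy).symm
  rw [ContinuousLinearMap.comp_apply, h3, coord_fr hy]
  have h4 := fderiv_multilinear_apply hS' ha' (coord y y X)
  simp only [Function.comp_apply, chart_symm_chart hy] at h4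
  exact h4

/-- The components of a covector in the chart at `c`. -/
def formCoord (c y : M) (b : TangentSpace (𝓡 n) y →L[ℝ] ℝ) : Covector (EuclideanSpace ℝ (Fin n)) :=
  Covector.equiv (b.comp (fr c y))

/-- The one-form with constant components in the chart at `c`. -/
def constForm (c : M) (b : EuclideanSpace ℝ (Fin n) →L[ℝ] ℝ) : OneForm n M :=
  fun y => b.comp (coord c y)

/-- In the trivialisation centred at `y`, the form is `b` composed with the coordinate change from
`y` to `c`, which is smooth. -/
theorem constForm_smoothAt {c y : M} (hy : y ∈ dom n c) (b : EuclideanSpace ℝ (Fin n) →L[ℝ] ℝ) :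
    (constForm c b).SmoothAt y := by
  unfold OneForm.SmoothAt
  rw [contMDiffAt_hom_bundle]
  refine ⟨contMDiffAt_id, ?_⟩
  have hy' := mem_dom_self (n := n) y
  have h1 : ContMDiffAt (𝓡 n) 𝓘(ℝ, EuclideanSpace ℝ (Fin n) →L[ℝ] EuclideanSpace ℝ (Fin n)) ∞
      (fun z => ((triv (n := n) y).coordChangeL ℝ (triv c) z :
        EuclideanSpace ℝ (Fin n) →L[ℝ] EuclideanSpace ℝ (Fin n))) y :=
    contMDiffAt_coordChangeL (mem_baseSet hy') (mem_baseSet hy)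
  refine ((contMDiffAt_const (c := b)).clm_comp h1).congr_of_eventuallyEq ?_
  filter_upwards [(isOpen_dom y).mem_nhds hy', (isOpen_dom c).mem_nhds hy] with z hz hz'
  ext v
  have h2 : coord c z (fr y z v) = (triv (n := n) y).coordChangeL ℝ (triv c) z v := by
    rw [Trivialization.coordChangeL_apply _ _ ⟨mem_baseSet hz, mem_baseSet hz'⟩, coord,
      Trivialization.continuousLinearMapAt_apply, Trivialization.coe_linearMapAt_of_mem _
        (mem_baseSet hz')]
    change (triv c ⟨z, (triv y).symmL ℝ z v⟩).2 = _
    rw [Trivialization.symmL_apply _ (mem_baseSet hz)]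
  refine Eq.trans ?_ (congrArg b h2)
  simp [ContinuousLinearMap.inCoordinates]
  rfl

theorem formCoord_constForm {c y : M} (hy : y ∈ dom n c) (b : EuclideanSpace ℝ (Fin n) →L[ℝ] ℝ) :
    formCoord c y (constForm c b y) = Covector.equiv b := by
  refine congrArg Covector.equiv (ContinuousLinearMap.ext fun v => ?_)
  exact congrArg b (coord_fr hy v)

theorem mdifferentiableAt_formCoord {c y : M} (hy : y ∈ dom n c) {α : OneForm n M}
    (hα : α.DiffAt y) :
    MDifferentiableAt (𝓡 n) 𝓘(ℝ, Covector (EuclideanSpace ℝ (Fin n)))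
      (fun z => formCoord c z (α z)) y := by
  refine mdifferentiableAt_of_comp_chart_symm hy ?_
  have h1 (j : Fin n) := differentiableAt_comp_chart_symm hy
    (hα.apply (fieldDiffAt_fr hy (EuclideanSpace.single j 1)))
  have h2 : (fun z => formCoord c z (α z)) = fun z =>
      ∑ j, α z (fr c z (EuclideanSpace.single j 1)) • Covector.equiv (EuclideanSpace.proj j) := by
    funext z
    have := congrArg Covector.equiv (covec_coord ((α z).comp (fr c z)))
    rw [covec, LinearMap.coe_mk, AddHom.coe_mk, map_sum] at this
    simp only [map_smul] at this
    exact this.symm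
  rw [h2]
  exact DifferentiableAt.fun_sum fun j _ => (h1 j).smul_const _

/-- Evaluating on coordinate fields, whose covariant derivative is `G` itself, turns the Leibniz
rule into `∇_X α = dα(X) - α ∘ G(X)`. -/
theorem formCoord_covDerivOneForm {cov : Connection n M} {c y : M} (hy : y ∈ dom n c)
    {G : Christoffel n} (hG : HasChristoffel cov c y G) {α : OneForm n M} (hα : α.DiffAt y)
    (X : TangentSpace (𝓡 n) y) :
    formCoord c y (covDerivOneForm cov α y X)
      = mvfderiv (𝓡 n) (fun z => formCoord c z (α z)) y X
        - Covector.dualMap (G (coord c y X)) (formCoord c y (α y)) := by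
  refine Covector.equiv.symm.injective (ContinuousLinearMap.ext fun w => ?_)
  have h1 := covDerivOneForm_apply cov hα X (fieldDiffAt_fr hy w)
  have h2 : mvfderiv (𝓡 n) (fun z => α z (fr c z w)) y X
      = Covector.eval w (mvfderiv (𝓡 n) (fun z => formCoord c z (α z)) y X) :=
    DFunLike.congr_fun (mvfderiv_comp_hasFDerivAt (Ψ := Covector.eval w)
      (Covector.eval w).hasFDerivAt (mdifferentiableAt_formCoord hy hα)) X
  have h3 : cov (fun z => fr c z w) y X = fr c y (G (coord c y X) w) := by
    rw [← hG.apply hy, fr_coord hy, fr_coord hy]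
  rw [h2, h3] at h1
  exact h1

/-- The components of a symbol in the chart at `c`. -/
def symT (σ : Symbol n k M) (c y : M) : Tensor k (EuclideanSpace ℝ (Fin n)) :=
  toTensor ((σ.toFun y).toMul.compLinearMap fun _ =>
    { toFun := fun b : EuclideanSpace ℝ (Fin n) →L[ℝ] ℝ => b.comp (coord c y)
      map_add' := fun _ _ => rfl
      map_smul' := fun _ _ => rfl })

theorem symT_equiv (σ : Symbol n k M) (c y : M) (b : Fin k → EuclideanSpace ℝ (Fin n) →L[ℝ] ℝ) :
    symT σ c y (fun i => Covector.equiv (b i))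
      = (σ.toFun y).toMul fun i => constForm c (b i) y :=
  toTensor_apply _ _

theorem symT_formCoord (σ : Symbol n k M) {c y : M} (hy : y ∈ dom n c)
    (α : Fin k → TangentSpace (𝓡 n) y →L[ℝ] ℝ) :
    symT σ c y (fun i => formCoord c y (α i)) = (σ.toFun y).toMul α := by
  simp only [formCoord]
  rw [symT_equiv]
  refine congrArg _ (funext fun i => ContinuousLinearMap.ext fun X => ?_)
  exact congrArg (α i) (fr_coord hy X)

theorem contMDiffAt_symT (σ : Symbol n k M) {c y : M} (hy : y ∈ dom n c) :
    ContMDiffAt (𝓡 n) 𝓘(ℝ, Tensor k (EuclideanSpace ℝ (Fin n))) ∞ (symT σ c) y := by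
  have h : symT σ c = fun y => ∑ I : Fin k → Fin n,
      ((σ.toFun y).toMul fun i => constForm c (EuclideanSpace.proj (I i)) y) •
        monomialTensor I := rfl
  rw [h]
  refine contMDiffAt_finsetSum fun I _ => ?_
  have h1 := σ.smooth y (fun i => constForm c (EuclideanSpace.proj (I i)))
    fun i => constForm_smoothAt hy _
  exact h1.smul (contMDiffAt_const (c := monomialTensor I))

theorem inf_toTensor_injective (hn : 1 ≤ n) {S : SymTensor k (EuclideanSpace ℝ (Fin n))}
    (hS : IsRegularForm k S.form) : Function.Injective (toTensor S.toMul).inf := by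
  rw [injective_iff_map_eq_zero]
  refine fun A hA => S.eq_zero_of_infinitesimal_symmetry hn hS A fun a => ?_
  have h := DFunLike.congr_fun hA fun i => Covector.equiv (a i)
  rw [Tensor.inf_apply] at h
  refine Eq.trans (Finset.sum_congr rfl fun i _ => ?_) h
  exact (toTensor_apply_update S.toMul a i _).symm

/-- The chart trivialisation at `y` is one of the isomorphisms tested by the constant type
condition. -/
theorem symT_mem_orbit {σ : Symbol n k M} {S : SymTensor k (EuclideanSpace ℝ (Fin n))}
    (hσ : σ.HasConstantType S.orbit) {c y : M} (hy : y ∈ dom n c) :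
    symT σ c y ∈ (toTensor S.toMul).orbit := by
  let e := (triv (n := n) c).continuousLinearEquivAt ℝ y (mem_baseSet hy)
  have h1 : (e : TangentSpace (𝓡 n) y →L[ℝ] EuclideanSpace ℝ (Fin n)) = coord c y :=
    ContinuousLinearMap.coeFn_injective
      (Trivialization.coe_continuousLinearEquivAt_eq _ (mem_baseSet hy))
  obtain ⟨g, hg⟩ := hσ y e
  refine ⟨g, g.symm, by ext v; simp, by ext v; simp, ?_⟩
  ext a
  have h2 := congrArg (fun T => T.toMul fun i => Covector.equiv.symm (a i)) hg
  refine (toTensor_apply _ fun i => Covector.equiv.symm (a i)).trans ?_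
  have h3 := toTensor_apply S.toMul fun i => (Covector.equiv.symm (a i)).comp
    (g : EuclideanSpace ℝ (Fin n) →L[ℝ] EuclideanSpace ℝ (Fin n))
  refine Eq.trans ?_ (h2.trans h3.symm)
  exact congrArg (fun L => (σ.toFun y).toMul fun i => (Covector.equiv.symm (a i)).comp L) h1.symm

/-- By the product rule the derivatives of the forms `α_i` cancel. The minus sign in `∇α = dα - α ∘
G` meets the minus sign in the definition of `∇σ`, leaving `dσ + G·σ`. -/
theorem covDerivSymbol_eq (σ : Symbol n k M) {cov : Connection n M} {c y : M} (hy : y ∈ dom n c)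
    {G : Christoffel n} (hG : HasChristoffel cov c y G) {α : Fin k → OneForm n M}
    (hα : ∀ i, (α i).SmoothAt y) (X : TangentSpace (𝓡 n) y) :
    covDerivSymbol cov σ α y X
      = (mvfderiv (𝓡 n) (symT σ c) y X + (symT σ c y).inf (G (coord c y X)))
        fun i => formCoord c y (α i y) := by
  have hα' (i : Fin k) : (α i).DiffAt y := (hα i).mdifferentiableAt (by simp)
  have h1 : (fun z => (σ.toFun z).toMul fun i => α i z)
      =ᶠ[nhds y] fun z => symT σ c z fun i => formCoord c z (α i z) := by
    filter_upwards [(isOpen_dom c).mem_nhds hy] with z hz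
    rw [symT_formCoord σ hz]
  have h2 (i : Fin k) : (σ.toFun y).toMul
        (Function.update (fun j => α j y) i (covDerivOneForm cov (α i) y X))
      = symT σ c y (Function.update (fun j => formCoord c y (α j y)) i
          (formCoord c y (covDerivOneForm cov (α i) y X))) := by
    rw [← symT_formCoord σ hy]
    refine congrArg _ (funext fun j => ?_)
    rcases eq_or_ne j i with rfl | hj
    · simp
    · simp [hj]
  rw [covDerivSymbol, mvfderiv_congr h1, mvfderiv_multilinear_apply (S := symT σ c)
    (a := fun i z => formCoord c z (α i z)) ((contMDiffAt_symT σ hy).mdifferentiableAt (by simp))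
    (fun i => mdifferentiableAt_formCoord hy (hα' i))]
  simp only [h2, formCoord_covDerivOneForm hy hG (hα' _), ContinuousMultilinearMap.map_update_sub,
    Finset.sum_sub_distrib, add_apply, Tensor.inf_apply]
  ring

/-- Forms with constant components suffice as test forms, since they realise every value at a point.
-/
theorem CovDerivEq.components {σ : Symbol n k M} {cov : Connection n M} {η : OneForm n M}
    (h : CovDerivEq cov σ η) {c y : M} (hy : y ∈ dom n c) {G : Christoffel n}
    (hG : HasChristoffel cov c y G) (X : TangentSpace (𝓡 n) y) :
    mvfderiv (𝓡 n) (symT σ c) y X + (symT σ c y).inf (G (coord c y X)) = η y X • symT σ c y := by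
  ext a
  have h1 := h y (fun i => constForm c (Covector.equiv.symm (a i)))
    (fun i => constForm_smoothAt hy _) X
  rw [covDerivSymbol_eq σ hy hG fun i => constForm_smoothAt hy _] at h1
  simp only [formCoord_constForm hy, ← symT_equiv] at h1
  exact h1

theorem covDerivEq_of_components {σ : Symbol n k M} {cov : Connection n M} {η : OneForm n M}
    (h : ∀ y : M, ∃ (c : M) (_ : y ∈ dom n c) (G : Christoffel n), HasChristoffel cov c y G ∧
      ∀ X : TangentSpace (𝓡 n) y, mvfderiv (𝓡 n) (symT σ c) y X
        + (symT σ c y).inf (G (coord c y X)) = η y X • symT σ c y) :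
    CovDerivEq cov σ η := by
  intro y α hα X
  obtain ⟨c, hy, G, hG, hX⟩ := h y
  rw [covDerivSymbol_eq σ hy hG hα, hX, ← symT_formCoord σ hy]
  rfl

end Components

/-! ### Connections preserving a symbol up to a factor -/

section Connections

set_option linter.unusedSectionVars false

variable {n k : ℕ} {M : Type*} [TopologicalSpace M] [ChartedSpace (EuclideanSpace ℝ (Fin n)) M]
  [IsManifold (𝓡 n) ∞ M]

/-- The Christoffel symbols in the chart at each point are smooth at that point. -/
def HasSmoothChristoffel (cov : Connection n M) : Prop :=
  ∀ c : M, ∃ G : M → Christoffel n, ContMDiffAt (𝓡 n) 𝓘(ℝ, Christoffel n) ∞ G c ∧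
    ∀ᶠ y in nhds c, HasChristoffel cov c y (G y)

theorem HasSmoothChristoffel.smoothConnection {cov : Connection n M}
    (h : HasSmoothChristoffel cov) : SmoothConnection cov :=
  smoothConnection_of_christoffel h

theorem contDiff_smulRight_const {V W : Type*} [NormedAddCommGroup V] [NormedSpace ℝ V]
    [NormedAddCommGroup W] [NormedSpace ℝ W] (w : W) :
    ContDiff ℝ ∞ fun b : V →L[ℝ] ℝ => b.smulRight w :=
  ContDiff.smulRight contDiff_id contDiff_const

theorem HasSmoothChristoffel.addScalarForm {cov : Connection n M} (h : HasSmoothChristoffel cov)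
    {η : OneForm n M} (hη : ∀ c : M, ContMDiffAt (𝓡 n) 𝓘(ℝ, EuclideanSpace ℝ (Fin n) →L[ℝ] ℝ) ∞
      (fun y => (η y).comp (fr c y)) c) :
    HasSmoothChristoffel (addScalarForm cov η) := by
  intro c
  obtain ⟨G, hG, hcov⟩ := h c
  refine ⟨fun y => G y + ((η y).comp (fr c y)).smulRight (.id ℝ (EuclideanSpace ℝ (Fin n))),
    hG.add ((contDiff_smulRight_const _).contMDiff.contMDiffAt.comp c (hη c)), ?_⟩
  filter_upwards [hcov, (isOpen_dom c).mem_nhds (mem_dom_self (n := n) c)] with y hy hyc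
  exact hy.addScalarForm hyc η

theorem HasSmoothChristoffel.contMDiffAt_torsionForm {cov : Connection n M}
    (h : HasSmoothChristoffel cov) (c : M) :
    ContMDiffAt (𝓡 n) 𝓘(ℝ, EuclideanSpace ℝ (Fin n) →L[ℝ] ℝ) ∞
      (fun y => (torsionForm cov y).comp (fr c y)) c := by
  obtain ⟨G, hG, hcov⟩ := h c
  refine ((contDiff_torsionTrace.contMDiff.contMDiffAt).comp c hG).congr_of_eventuallyEq ?_
  filter_upwards [hcov, (isOpen_dom c).mem_nhds (mem_dom_self (n := n) c)] with y hy hyc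
  exact hy.torsionForm_comp_fr hyc

theorem oneForm_ext {α β : OneForm n M}
    (h : ∀ x, (α x).comp (fr x x) = (β x).comp (fr x x)) : α = β := by
  funext x
  ext X
  have h1 := DFunLike.congr_fun (h x) (coord x x X)
  simpa [fr_coord (mem_dom_self (n := n) x)] using h1

theorem torsionForm_addScalarForm (cov : Connection n M) (η : OneForm n M) :
    torsionForm (addScalarForm cov η) = fun x => torsionForm cov x + ((n : ℝ) - 1) • η x := by
  refine oneForm_ext fun x => ?_
  have hx := mem_dom_self (n := n) x
  obtain ⟨G, hG⟩ := exists_hasChristoffel cov hx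
  rw [(hG.addScalarForm hx η).torsionForm_comp_fr hx, torsionTrace_add, torsionTrace_smulRight_id,
    ← hG.torsionForm_comp_fr hx]
  rfl

theorem SameConnection.hasChristoffel {cov cov' : Connection n M} (h : SameConnection cov cov')
    {c y : M} {G : Christoffel n} (hG : HasChristoffel cov c y G) : HasChristoffel cov' c y G := by
  intro Y hY X
  rw [← h Y y hY]
  exact hG Y hY X

theorem CovDerivEq.congr {σ : Symbol n k M} {cov cov' : Connection n M} {η : OneForm n M}
    (h : CovDerivEq cov σ η) (hcov : SameConnection cov cov') : CovDerivEq cov' σ η := by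
  refine covDerivEq_of_components fun y => ?_
  have hy := mem_dom_self (n := n) y
  obtain ⟨G, hG⟩ := exists_hasChristoffel cov hy
  exact ⟨y, hy, G, hcov.hasChristoffel hG, h.components hy hG⟩

theorem CovDerivEq.addScalarForm {σ : Symbol n k M} {cov : Connection n M} {ζ : OneForm n M}
    (h : CovDerivEq cov σ ζ) (η : OneForm n M) :
    CovDerivEq (addScalarForm cov η) σ (fun x => ζ x + (k : ℝ) • η x) := by
  refine covDerivEq_of_components fun y => ?_
  have hy := mem_dom_self (n := n) y
  obtain ⟨G, hG⟩ := exists_hasChristoffel cov hy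
  refine ⟨y, hy, _, hG.addScalarForm hy η, fun X => ?_⟩
  have h1 : (G + ((η y).comp (fr y y)).smulRight (.id ℝ (EuclideanSpace ℝ (Fin n))) :
        Christoffel n) (coord y y X)
      = G (coord y y X) + η y X • ContinuousLinearMap.id ℝ (EuclideanSpace ℝ (Fin n)) := by
    simp [fr_coord hy]
  have h2 : (ζ y + (k : ℝ) • η y) X = ζ y X + k * η y X := rfl
  rw [h1, map_add, map_smul, Tensor.inf_id, ← add_assoc, h.components hy hG, h2]
  module

theorem symT_of_smul {σ τ : Symbol n k M} {f : M → ℝ}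
    (h : ∀ x, (τ.toFun x).toMul = f x • (σ.toFun x).toMul) (c y : M) :
    symT τ c y = f y • symT σ c y := by
  ext a
  have h1 := symT_equiv τ c y fun i => Covector.equiv.symm (a i)
  rw [h y] at h1
  exact h1.trans (congrArg (f y • ·) (symT_equiv σ c y fun i => Covector.equiv.symm (a i)).symm)

theorem smul_add_smul_eq {W : Type*} [AddCommGroup W] [Module ℝ W] {r : ℝ} (hr : r ≠ 0) (e d : ℝ)
    (T : W) : r • e • T + d • T = (e + r⁻¹ * d) • r • T := by
  rw [smul_smul, smul_smul, ← add_smul]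
  congr 1
  field_simp

/-- From `∇(fσ) = df σ + f ∇σ`, the proportionality form gains `df / f`. -/
theorem CovDerivEq.smul {σ τ : Symbol n k M} {f : M → ℝ} (hf : ContMDiff (𝓡 n) 𝓘(ℝ) ∞ f)
    (hf0 : ∀ x, f x ≠ 0) (hτ : ∀ x, (τ.toFun x).toMul = f x • (σ.toFun x).toMul)
    {cov : Connection n M} {η : OneForm n M} (h : CovDerivEq cov σ η) :
    CovDerivEq cov τ (fun x => η x + (f x)⁻¹ • mvfderiv (𝓡 n) f x) := by
  refine covDerivEq_of_components fun y => ?_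
  have hy := mem_dom_self (n := n) y
  obtain ⟨G, hG⟩ := exists_hasChristoffel cov hy
  refine ⟨y, hy, G, hG, fun X => ?_⟩
  have h1 : symT τ y = fun z => f z • symT σ y z := funext fun z => symT_of_smul hτ y z
  have h2 := mvfderiv_fun_smul ((hf y).mdifferentiableAt (by simp))
    ((contMDiffAt_symT σ hy).mdifferentiableAt (by simp))
  have h3 : (η y + (f y)⁻¹ • mvfderiv (𝓡 n) f y) X = η y X + (f y)⁻¹ * mvfderiv (𝓡 n) f y X := rfl
  have h4 : (f y • mvfderiv (𝓡 n) (symT σ y) y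
        + (mvfderiv (𝓡 n) f y).smulRight (symT σ y y)) X
      = f y • mvfderiv (𝓡 n) (symT σ y) y X + mvfderiv (𝓡 n) f y X • symT σ y y := rfl
  have h5 : (f y • symT σ y y).inf (G (coord y y X))
      = f y • (symT σ y y).inf (G (coord y y X)) := by rw [Tensor.inf_smul]; rfl
  have h6 := h.components hy hG X
  rw [h1, h2, h4, h5, h3, add_right_comm, ← smul_add, h6]
  exact smul_add_smul_eq (hf0 y) _ _ _

theorem christoffel_eq_of_covDerivEq {σ : Symbol n k M}
    (hσ : ∀ x, Function.Injective (symT σ x x).inf) {cov cov' : Connection n M} {η : OneForm n M}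
    (h : CovDerivEq cov σ η) (h' : CovDerivEq cov' σ η) {x : M} {G G' : Christoffel n}
    (hG : HasChristoffel cov x x G) (hG' : HasChristoffel cov' x x G') : G = G' := by
  have hx := mem_dom_self (n := n) x
  ext1 v
  refine hσ x ?_
  have h1 := h.components hx hG (fr x x v)
  rw [← h'.components hx hG' (fr x x v), coord_fr hx] at h1
  exact add_left_cancel h1

theorem sameConnection_of_covDerivEq {σ : Symbol n k M}
    (hσ : ∀ x, Function.Injective (symT σ x x).inf) {cov cov' : Connection n M} {η : OneForm n M}
    (h : CovDerivEq cov σ η) (h' : CovDerivEq cov' σ η) : SameConnection cov cov' :=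
  sameConnection_of_christoffel fun _ _ _ hG hG' => christoffel_eq_of_covDerivEq hσ h h' hG hG'

/-- A connection with zero torsion form which preserves the conformal class is unique. -/
theorem sameConnection_of_torsionForm_eq_zero (hn : 2 ≤ n) (hk : k ≠ 0) {σ : Symbol n k M}
    (hσ : ∀ x, Function.Injective (symT σ x x).inf) {cov cov' : Connection n M} {η η' : OneForm n M}
    (h : CovDerivEq cov σ η) (h' : CovDerivEq cov' σ η') (ht : torsionForm cov = 0)
    (ht' : torsionForm cov' = 0) : SameConnection cov cov' := by
  have hk' : (k : ℝ) ≠ 0 := by exact_mod_cast hk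
  have hn' : (n : ℝ) - 1 ≠ 0 := by
    have : (2 : ℝ) ≤ n := by exact_mod_cast hn
    linarith
  -- Chosen so that `η' + kζ = η`: after the shift both connections have the same proportionality
  -- form, hence coincide by injectivity. Comparing torsion forms then gives `(n - 1) ζ = 0`.
  let ζ : OneForm n M := fun x => (k : ℝ)⁻¹ • (η x - η' x)
  have h1 : CovDerivEq (addScalarForm cov' ζ) σ η := by
    convert h'.addScalarForm ζ using 2 with x
    simp only [ζ, smul_smul, mul_inv_cancel₀ hk', one_smul]
    abel
  refine sameConnection_of_christoffel fun x G G' hG hG' => ?_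
  have hx := mem_dom_self (n := n) x
  have h2 := christoffel_eq_of_covDerivEq hσ h h1 hG (hG'.addScalarForm hx ζ)
  have h3 := hG.torsionForm_comp_fr hx
  have h4 := hG'.torsionForm_comp_fr hx
  have h5 : (0 : EuclideanSpace ℝ (Fin n) →L[ℝ] ℝ) = torsionTrace G := by
    rw [← h3, ht]; rfl
  have h6 : (0 : EuclideanSpace ℝ (Fin n) →L[ℝ] ℝ) = torsionTrace G' := by
    rw [← h4, ht']; rfl
  rw [h2, torsionTrace_add, ← h6, torsionTrace_smulRight_id, zero_add] at h5
  have h7 := (smul_eq_zero.1 h5.symm).resolve_left hn'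
  rw [h2, h7]
  ext1 v
  ext1 w
  change G' v w + (0 : ℝ) • w = G' v w
  rw [zero_smul, add_zero]

/-- The normalisation of a connection to zero torsion form. -/
theorem torsionForm_normalised (hn : 2 ≤ n) (cov : Connection n M) :
    torsionForm (addScalarForm cov fun x => (-(1 / ((n : ℝ) - 1))) • torsionForm cov x) = 0 := by
  have hn' : (n : ℝ) - 1 ≠ 0 := by
    have : (2 : ℝ) ≤ n := by exact_mod_cast hn
    linarith
  rw [torsionForm_addScalarForm]
  funext x
  ext X
  change torsionForm cov x X + ((n : ℝ) - 1) * (-(1 / ((n : ℝ) - 1)) * torsionForm cov x X) = 0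
  field_simp
  ring

theorem contMDiffAt_smul_comp_fr {η : OneForm n M} {c : M} {f : M → ℝ}
    (hη : ContMDiffAt (𝓡 n) 𝓘(ℝ, EuclideanSpace ℝ (Fin n) →L[ℝ] ℝ) ∞
      (fun y => (η y).comp (fr c y)) c) (hf : ContMDiffAt (𝓡 n) 𝓘(ℝ) ∞ f c) :
    ContMDiffAt (𝓡 n) 𝓘(ℝ, EuclideanSpace ℝ (Fin n) →L[ℝ] ℝ) ∞
      (fun y => (f y • η y).comp (fr c y)) c :=
  hf.smul hη

/-- Existence of a Wagner connection with smooth Christoffel symbols. -/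
theorem exists_parallel_connection (hn : 1 ≤ n) {S : SymTensor k (EuclideanSpace ℝ (Fin n))}
    (hS : IsRegularForm k S.form) {σ : Symbol n k M} (hσ : σ.HasConstantType S.orbit) :
    ∃ cov : Connection n M, HasSmoothChristoffel cov ∧ CovDerivEq cov σ 0 := by
  have hinj : ∀ {c y : M}, y ∈ dom n c → Function.Injective (symT σ c y).inf := fun hy =>
    Tensor.inf_injective_of_mem_orbit (inf_toTensor_injective hn hS) (symT_mem_orbit hσ hy)
  have key (c : M) : ∃ G : M → Christoffel n, ContMDiffAt (𝓡 n) 𝓘(ℝ, Christoffel n) ∞ G c ∧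
      ∀ᶠ y in nhds c, ∀ v, (symT σ c y).inf (G y v) = -mvfderiv (𝓡 n) (symT σ c) y (fr c y v) := by
    have hc := mem_dom_self (n := n) c
    obtain ⟨G, hG, hGe⟩ := Tensor.exists_contDiffAt_inf_eq_neg_fderiv
      (inf_toTensor_injective hn hS) (F := symT σ c ∘ (extChartAt (𝓡 n) c).symm)
      (isOpen_extChartAt_target (I := 𝓡 n) c)
      (fun z hz => by
        have h1 := (extChartAt (𝓡 n) c).map_target hz
        rw [extChartAt_source] at h1
        have h2 := contDiffAt_comp_chart_symm h1 (contMDiffAt_symT σ h1)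
        rw [(extChartAt (𝓡 n) c).right_inv hz] at h2
        exact h2.contDiffWithinAt)
      (fun z hz => by
        have h1 := (extChartAt (𝓡 n) c).map_target hz
        rw [extChartAt_source] at h1
        exact symT_mem_orbit hσ h1)
      (mem_extChartAt_target (I := 𝓡 n) c)
    refine ⟨fun y => G (extChartAt (𝓡 n) c y), hG.contMDiffAt.comp c (contMDiffAt_chart hc), ?_⟩
    filter_upwards [(continuousAt_extChartAt (I := 𝓡 n) c).eventually hGe,
      (isOpen_dom c).mem_nhds hc] with y hy hyc v
    have h1 := hy v
    rw [mvfderiv_fr_eq_fderiv hyc ((contMDiffAt_symT σ hyc).mdifferentiableAt (by simp)), ← h1,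
      Function.comp_apply, chart_symm_chart hyc]
  choose Γ hΓ hΓe using key
  -- At each point the connection is defined by the local solution of the chart centred there.
  have hpar : CovDerivEq (ofChristoffel fun x => Γ x x) σ 0 := by
    refine covDerivEq_of_components fun y => ?_
    have hy := mem_dom_self (n := n) y
    refine ⟨y, hy, _, hasChristoffel_ofChristoffel _ y, fun X => ?_⟩
    rw [(hΓe y).self_of_nhds, fr_coord hy, add_neg_cancel]
    exact (zero_smul ℝ _).symm
  refine ⟨_, fun c => ⟨Γ c, hΓ c, ?_⟩, hpar⟩
  -- Smoothness must be checked in one fixed chart. By injectivity the Christoffel symbols in the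
  -- chart at `c` are the smooth local solution `Γ c`, which solves the same equation.
  filter_upwards [hΓe c, (isOpen_dom c).mem_nhds (mem_dom_self (n := n) c)] with y hy hyc
  obtain ⟨G, hG⟩ := exists_hasChristoffel (ofChristoffel fun x => Γ x x) hyc
  convert hG
  ext1 v
  refine hinj hyc ?_
  have h1 := hpar.components hyc hG (fr c y v)
  rw [coord_fr hyc] at h1
  rw [hy v, neg_eq_iff_add_eq_zero, h1]
  exact zero_smul ℝ _

end Connections
end ChernConn

end

/-! ### The Wagner and Chern connections -/

open ChernConn in
theorem mainTheorem7 {n k : ℕ} (hn : 2 ≤ n) (hk : 3 ≤ k)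
    {M : Type*} [TopologicalSpace M] [T2Space M] [ChartedSpace (EuclideanSpace ℝ (Fin n)) M]
    [IsManifold (𝓡 n) ∞ M] (σ : Symbol n k M)
    (ϖ : Set (SymTensor k (EuclideanSpace ℝ (Fin n)))) (hϖ : IsRegularOrbit ϖ)
    (hσ : σ.HasConstantType ϖ) :
    (∀ τ ∈ σ.conformalClass, ∃ covW : Connection n M, IsWagner covW τ ∧
      ∀ cov' : Connection n M, IsWagner cov' τ → SameConnection cov' covW) ∧
    ∃ covC : Connection n M, SmoothConnection covC ∧
      (∀ τ ∈ σ.conformalClass, ∀ covW : Connection n M, IsWagner covW τ →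
        SameConnection covC (addScalarForm covW fun x => (-(1 / ((n : ℝ) - 1))) • torsionForm covW x) ∧
        CovDerivEq covC τ (fun x => (-((k : ℝ) / ((n : ℝ) - 1))) • torsionForm covW x) ∧
        ∀ cov' : Connection n M, SmoothConnection cov' →
          CovDerivEq cov' τ (fun x => (-((k : ℝ) / ((n : ℝ) - 1))) • torsionForm covW x) →
          SameConnection cov' covC) ∧
      torsionForm covC = 0 ∧
      PreservesConformalClass covC σ ∧
      ∀ cov' : Connection n M, SmoothConnection cov' → PreservesConformalClass cov' σ →
        torsionForm cov' = 0 → SameConnection cov' covC := by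
  obtain ⟨S, hS, rfl⟩ := hϖ
  have hn1 : 1 ≤ n := by omega
  have hk0 : k ≠ 0 := by omega
  have hk' : (k : ℝ) ≠ 0 := by exact_mod_cast hk0
  obtain ⟨cov₀, hsm, hpar⟩ := exists_parallel_connection hn1 hS hσ
  have hinj : ∀ τ ∈ σ.conformalClass, ∀ x, Function.Injective (symT τ x x).inf := by
    rintro τ ⟨f, _, hf0, hτ⟩ x
    have h1 := Tensor.inf_injective_of_mem_orbit (inf_toTensor_injective hn1 hS)
      (symT_mem_orbit hσ (mem_dom_self (n := n) x))
    -- Injectivity passes from `σ` to `fσ` by rescaling, so `fσ` need not be placed in the orbit of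
    -- `S`.
    rw [symT_of_smul hτ, Tensor.inf_smul]
    exact fun A B hAB => h1 (smul_right_injective _ (hf0 x) hAB)
  have hσσ : σ ∈ σ.conformalClass :=
    ⟨fun _ => 1, contMDiff_const, fun _ => one_ne_zero, fun x => (one_smul ℝ _).symm⟩
  refine ⟨?_, ?_⟩
  · intro τ hτc
    obtain ⟨f, hf, hf0, hτ⟩ := hτc
    -- Solves `df/f + kη = 0`, so that adding `η` compensates the passage from `σ` to `fσ`.
    let η : OneForm n M := fun x => (-((k : ℝ)⁻¹ * (f x)⁻¹)) • mvfderiv (𝓡 n) f x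
    have hη (c : M) : ContMDiffAt (𝓡 n) 𝓘(ℝ, EuclideanSpace ℝ (Fin n) →L[ℝ] ℝ) ∞
        (fun y => (η y).comp (fr c y)) c :=
      contMDiffAt_smul_comp_fr (contMDiffAt_mvfderiv_comp_fr (mem_dom_self c) (hf c))
        ((contMDiffAt_const.mul ((hf c).inv₀ (hf0 c))).neg)
    have hW : CovDerivEq (addScalarForm cov₀ η) τ 0 := by
      convert (hpar.smul hf hf0 hτ).addScalarForm η using 1
      funext x
      ext X
      change (0 : ℝ) = (0 + (f x)⁻¹ * mvfderiv (𝓡 n) f x X)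
        + (k : ℝ) * (-((k : ℝ)⁻¹ * (f x)⁻¹) * mvfderiv (𝓡 n) f x X)
      field_simp
      ring
    exact ⟨_, ⟨(hsm.addScalarForm hη).smoothConnection, hW⟩, fun cov' h' =>
      sameConnection_of_covDerivEq (hinj τ ⟨f, hf, hf0, hτ⟩) h'.2 hW⟩
  · have hC := hpar.addScalarForm fun x => (-(1 / ((n : ℝ) - 1))) • torsionForm cov₀ x
    have hCt := torsionForm_normalised hn cov₀
    refine ⟨_, (hsm.addScalarForm fun c => contMDiffAt_smul_comp_fr
      (hsm.contMDiffAt_torsionForm c) contMDiffAt_const).smoothConnection, ?_, hCt, ⟨_, hC⟩, ?_⟩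
    · intro τ hτc covW hW
      obtain ⟨f, hf, hf0, hτ⟩ := id hτc
      have h1 := hW.2.addScalarForm fun x => (-(1 / ((n : ℝ) - 1))) • torsionForm covW x
      -- The normalised Wagner connection of any other `τ` also preserves the class and has zero
      -- torsion form, hence is the same connection; this is independence of the representative.
      have h2 := sameConnection_of_torsionForm_eq_zero hn hk0 (hinj τ hτc)
        (hC.smul hf hf0 hτ) h1 hCt (torsionForm_normalised hn covW)
      have h3 := h1.congr fun Y x hY => (h2 Y x hY).symm
      have h4 : (fun x => (0 : OneForm n M) x +
            (k : ℝ) • (-(1 / ((n : ℝ) - 1))) • torsionForm covW x)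
          = fun x => (-((k : ℝ) / ((n : ℝ) - 1))) • torsionForm covW x := by
        funext x
        ext X
        change (0 : ℝ) + (k : ℝ) * (-(1 / ((n : ℝ) - 1)) * torsionForm covW x X)
          = -((k : ℝ) / ((n : ℝ) - 1)) * torsionForm covW x X
        ring
      rw [h4] at h3
      exact ⟨h2, h3, fun cov' _ h' => sameConnection_of_covDerivEq (hinj τ hτc) h' h3⟩
    · rintro cov' _ ⟨η', h'⟩ ht'
      exact sameConnection_of_torsionForm_eq_zero hn hk0 (hinj σ hσσ) h' hC ht' hCt
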